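/- **Setting.** Let $V$ be a set of $n\ge 1$ observed nodes. Each of $M\ge 1$ entities $i$ has a causal DAG $\mathcal D_i$ over $V$ and finitely many latent nodes $L_i$. Its observational law and its laws under each (randomized) atomic intervention $\mathrm{do}(w)$, $w\in V$, satisfy the causal Markov condition and faithfulness: a conditional independence of two observed variables given other observed variables holds exactly when the corresponding d-separation holds in $\mathcal D_i$, respectively in $\mathcal D_i$ with the edges into $w$ removed. CI-tests are exact. Let $\mathcal M_i$ be the maximal ancestral graph (MAG) of $\mathcal D_i$ on $V$: $u\ne v$ are adjacent iff $\mathcal D_i$ has an inducing path between them relative to $L_i$; the edge is $u\to v$ if $u$ is an ancestor of $v$ in $\mathcal D_i$, $u\leftarrow v$ if $v$ is an ancestor of $u$, and $u\leftrightarrow v$ otherwise. Let $\mathcal U_i$ be its partial ancestral graph (PAG): the same adjacencies, with an arrowhead or tail where all MAGs (with directed and bidirected edges) that are Markov equivalent to $\mathcal M_i$ share it, and a circle elsewhere. Let $N_i(u)$ be the set of neighbours of $u$ in $\mathcal M_i$, each with the type of its edge ($u\to v$, $u\leftarrow v$ or $u\leftrightarrow v$), let $d(\mathcal M,\mathcal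 M')$ be the number of nodes at which two graphs have different such sets, and let $\Delta=\max_{i,u}|N_i(u)|$. For $\alpha>\beta\ge 0$, the MAGs satisfy $(\alpha,\beta)$-clustering with clusters $C^\star_1,\dots,C^\star_k$ (a partition of $\{1,\dots,M\}$ into non-empty sets) if $d(\mathcal M_i,\mathcal M_j)\le\beta n$ for $i,j$ in the same cluster and $d(\mathcal M_i,\mathcal M_j)\ge\alpha n$ for $i,j$ in different clusters. Let $\gamma_a$ be the largest fraction of the entities of $C^\star_a$ that share one and the same MAG. **Algorithm $(\alpha,\beta)$-Recovery** (input: $\alpha,\beta,\delta$, the PAGs, access to CI-tests). To *learn* $N_i(u)$: - put into $\mathrm{Out}$ all $v$ with $u\to v$ in $\mathcal U_i$, and all $v$ with $u\,{\circ\!\!-\!\!\circ}\,v$ or $u\,{\circ\!\!\to}\,v$ in $\mathcal U_i$ for which $u,v$ are dependent under $\mathrm{do}(u)$; - put into $\mathrm{Bi}$ all $v$ with $u\leftrightarrow v$ in $\mathcal U_i$, and all $v$ with $u\,{\circ\!\!-\!\!\circ}\,v$, $u\,{\circ\!\!\to}\,v$ or $u\,{\leftarrow\!\!\circ}\,v$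 in $\mathcal U_i$ for which $u,v$ are independent under $\mathrm{do}(u)$ and under $\mathrm{do}(v)$; - the other neighbours of $u$ in $\mathcal U_i$ are incoming. (1) Sample a list $S$ of $\lfloor 4\log(M/\delta)/(\alpha-\beta)^2\rfloor$ nodes uniformly from $V$ with replacement and learn $N_i(u)$ for all $i$ and all $u\in S$. Join $i$ and $j$ if the learned sets $N_i(u)$, $N_j(u)$ agree for at least $(1-\frac{\alpha+\beta}{2})|S|$ of the $u\in S$. The connected components are the clusters found. (2) Assign to every entity an independent uniform node of $V$. For every cluster found and every node $u$, let $T_u$ be the set of its entities assigned to $u$; learn $N_i(u)$ for $i\in T_u$, choose $i\in T_u$ (ties broken by any fixed rule) for which the number of $j\in T_u\setminus\{i\}$ with $N_j(u)=N_i(u)$ is largest, and give $u$ the neighbourhood $N_i(u)$ (the empty one if $T_u=\emptyset$). The graph $\hat{\mathcal M}_i$ of every entity $i$ of the cluster consists of all edges obtained in this way. **Theorem.** There is a universal constant $K>0$ such that the following holds for all such data and all $0<\delta<1$. Suppose that $\mathcal M_1,\dots,\mathcal M_M$ satisfy $(\alpha,\beta)$-clustering with clusters $C^\star_1,\dots,C^\star_k$,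 and that for every $a$ $$\gamma_a>\tfrac12\qquad\text{and}\qquad |C^\star_a|\ \ge\ K\,\frac{n\log(nM/\delta)}{(2\gamma_a-1)^2}.$$ Then, with probability at least $1-\delta$ over the random choices of the algorithm, Algorithm $(\alpha,\beta)$-Recovery outputs MAGs $\hat{\mathcal M}_1,\dots,\hat{\mathcal M}_M$ such that $d(\mathcal M_i,\hat{\mathcal M}_i)\le\beta n$ for every entity $i$. For every outcome of the random choices, every entity undergoes at most $$(\Delta+1)+\frac{4(\Delta+1)\log(M/\delta)}{(\alpha-\beta)^2}$$ atomic interventions. -/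

import Mathlib

open MeasureTheory ProbabilityTheory

namespace CollabCausal

/-! Mixed graphs, ancestors, paths, m-separation, inducing paths, MAGs -/

/-- A mixed graph: directed edges `dir u v` (that is, `u → v`) and bidirected edges
`bi u v` (that is, `u ↔ v`) between distinct nodes. -/
@[ext]
structure MixedGraph (W : Type) where
  dir : W → W → Prop
  bi : W → W → Prop
  bi_symm : ∀ u v, bi u v → bi v u
  bi_irrefl : ∀ u, ¬ bi u u

namespace MixedGraph

variable {W : Type} (G : MixedGraph W)

/-- `u` and `v` are joined by an edge. -/
def Adj (u v : W) : Prop := G.dir u v ∨ G.dir v u ∨ G.bi u v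

/-- There is an edge between `x` and `w` with an arrowhead at `w`. -/
def Into (x w : W) : Prop := G.dir x w ∨ G.bi x w

/-- `u` is an ancestor of `v`: `u = v` or there is a directed path from `u` to `v`. -/
def Anc (u v : W) : Prop := Relation.ReflTransGen G.dir u v

/-- `p` is the node list of a path (pairwise distinct nodes, consecutive ones adjacent)
from `u` to `v`. -/
structure IsPath (p : List W) (u v : W) : Prop where
  chain : p.IsChain G.Adj
  nodup : p.Nodup
  head : p.head? = some u
  last : p.getLast? = some v

/-- The middle node of the consecutive triple `a, w, b` of a path is a collider. -/
def Collider (a w b : W) : Prop := G.Into a w ∧ G.Into b w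

/-- `p` is m-connecting between `u` and `v` relative to `Z`. -/
def MConnecting (p : List W) (u v : W) (Z : Set W) : Prop :=
  G.IsPath p u v ∧ ∀ a w b, [a, w, b] <:+: p →
    (¬ G.Collider a w b → w ∉ Z) ∧ (G.Collider a w b → ∃ z ∈ Z, G.Anc w z)

/-- `u` and `v` are m-separated by `Z` (meant for distinct `u, v` outside `Z`). On a directed
acyclic graph this is d-separation. -/
def MSep (u v : W) (Z : Set W) : Prop := ¬ ∃ p, G.MConnecting p u v Z

/-- There is an inducing path between `u` and `v` relative to `S`. -/
def Inducing (S : Set W) (u v : W) : Prop :=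
  ∃ p, G.IsPath p u v ∧ ∀ a w b, [a, w, b] <:+: p →
    (w ∉ S → G.Collider a w b) ∧ (G.Collider a w b → G.Anc w u ∨ G.Anc w v)

theorem Inducing.symm {G : MixedGraph W} {S : Set W} {u v : W} (h : G.Inducing S u v) :
    G.Inducing S v u := by
  obtain ⟨p, ⟨hc, hn, hh, hl⟩, hp⟩ := h
  refine ⟨p.reverse, ⟨?_, by simpa using hn, by simpa using hl, by simpa using hh⟩, ?_⟩
  · rw [List.isChain_reverse]
    refine hc.imp ?_
    rintro a b (h | h | h)
    · exact Or.inr (Or.inl h)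
    · exact Or.inl h
    · exact Or.inr (Or.inr (G.bi_symm _ _ h))
  · intro a w b hw
    have h1 : [b, w, a] <:+: p := by
      rw [← List.reverse_infix]; simpa using hw
    obtain ⟨h2, h3⟩ := hp b w a h1
    exact ⟨fun h => (h2 h).symm, fun h => (h3 h.symm).symm⟩

/-- No directed cycles, and no directed path between the ends of a bidirected edge. -/
def IsAncestral : Prop :=
  (∀ u, ¬ Relation.TransGen G.dir u u) ∧
    ∀ u v, G.bi u v → ¬ Relation.TransGen G.dir u v ∧ ¬ Relation.TransGen G.dir v u

/-- Maximal ancestral graphs. -/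
def IsMAG : Prop :=
  G.IsAncestral ∧ ∀ u v, u ≠ v → ¬ G.Adj u v → ¬ G.Inducing ∅ u v

/-- The two graphs have the same m-separations. -/
def MarkovEquiv (G H : MixedGraph W) : Prop :=
  ∀ (u v : W) (Z : Set W), u ≠ v → u ∉ Z → v ∉ Z → (G.MSep u v Z ↔ H.MSep u v Z)

/-- The Markov equivalence class `[G]`: all MAGs with the m-separations of `G`. -/
def markovClass : Set (MixedGraph W) := {H | H.IsMAG ∧ G.MarkovEquiv H}

end MixedGraph

/-! Incidence sets and the node-distance -/

/-- The type of an edge at a node `u`: `tail` for `u → v`, `head` for `u ← v`,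
`bidirected` for `u ↔ v`. -/
inductive EdgeType
  | tail
  | head
  | bidirected

namespace MixedGraph

variable {W : Type}

/-- The incidence set `N(u)`. -/
def incidence (G : MixedGraph W) (u : W) : Set (W × EdgeType) :=
  {x | (x.2 = EdgeType.tail ∧ G.dir u x.1) ∨ (x.2 = EdgeType.head ∧ G.dir x.1 u) ∨
    (x.2 = EdgeType.bidirected ∧ G.bi u x.1)}

/-- The node-distance: the number of nodes at which the incidence sets differ. -/
noncomputable def nodeDist (G H : MixedGraph W) : ℕ :=
  {u : W | G.incidence u ≠ H.incidence u}.ncard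

/-- The graph that has all the edges listed in the given incidence sets. -/
def ofIncidence (N : W → Set (W × EdgeType)) : MixedGraph W where
  dir u v := (v, EdgeType.tail) ∈ N u ∨ (u, EdgeType.head) ∈ N v
  bi u v := u ≠ v ∧ ((v, EdgeType.bidirected) ∈ N u ∨ (u, EdgeType.bidirected) ∈ N v)
  bi_symm := fun _ _ h => ⟨h.1.symm, h.2.symm⟩
  bi_irrefl := fun _ h => h.1 rfl

end MixedGraph

/-! Causal DAGs with latent nodes, and their MAGs -/

/-- A directed acyclic graph. -/
structure DAG (W : Type) where
  edge : W → W → Prop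
  acyclic : ∀ u, ¬ Relation.TransGen edge u u

namespace DAG

variable {W : Type}

/-- A DAG as a mixed graph without bidirected edges. -/
def toMixed (D : DAG W) : MixedGraph W where
  dir := D.edge
  bi _ _ := False
  bi_symm := fun _ _ h => h
  bi_irrefl := fun _ h => h

/-- The graph after an intervention on `w`: the edges into `w` are removed. -/
def mutilate (D : DAG W) (w : W) : DAG W where
  edge x y := D.edge x y ∧ y ≠ w
  acyclic u h := D.acyclic u (Relation.TransGen.mono (fun _ _ hxy => hxy.1) _ _ h)

/-- The MAG over the observed nodes `V` of a DAG over observed and latent nodes. -/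
def mag {V L : Type} (D : DAG (V ⊕ L)) : MixedGraph V where
  dir u v := u ≠ v ∧ D.toMixed.Inducing (Set.range Sum.inr) (Sum.inl u) (Sum.inl v) ∧
    D.toMixed.Anc (Sum.inl u) (Sum.inl v)
  bi u v := u ≠ v ∧ D.toMixed.Inducing (Set.range Sum.inr) (Sum.inl u) (Sum.inl v) ∧
    ¬ D.toMixed.Anc (Sum.inl u) (Sum.inl v) ∧ ¬ D.toMixed.Anc (Sum.inl v) (Sum.inl u)
  bi_symm := fun _ _ h => ⟨h.1.symm, h.2.1.symm, h.2.2.2, h.2.2.1⟩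
  bi_irrefl := fun _ h => h.1 rfl

end DAG

/-! Entities -/

/-- An entity: a causal DAG over the observed nodes `V` and its own finitely many latent nodes,
and the joint law of the observed variables, observationally (`law none`) and under the
(randomized) atomic intervention on `w` (`law (some w)`). -/
structure Entity (V : Type) where
  Latent : Type
  [finLatent : Finite Latent]
  dag : DAG (V ⊕ Latent)
  Val : V → Type
  [measVal : ∀ v, MeasurableSpace (Val v)]
  [borelVal : ∀ v, StandardBorelSpace (Val v)]
  law : Option V → Measure (∀ v, Val v)
  [probLaw : ∀ t, IsProbabilityMeasure (law t)]

namespace Entity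

attribute [instance] Entity.finLatent Entity.measVal Entity.borelVal Entity.probLaw

variable {V : Type}

/-- The MAG of the entity. -/
def mag (E : Entity V) : MixedGraph V := E.dag.mag

/-- The causal graph of the observational (`none`) or interventional (`some w`) law. -/
def graph (E : Entity V) : Option V → MixedGraph (V ⊕ E.Latent)
  | none => E.dag.toMixed
  | some w => (E.dag.mutilate (Sum.inl w)).toMixed

/-- The outcome of the CI-test of `u` and `v` given `Z` in the observational (`none`) or
interventional (`some w`) law: conditional independence of the variables. -/
def CI [Finite V] (E : Entity V) (t : Option V) (u v : V) (Z : Set V) : Prop :=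
  CondIndepFun
    (MeasurableSpace.comap (fun (x : ∀ v, E.Val v) (z : Z) => x z) inferInstance)
    (Measurable.comap_le (by fun_prop))
    (fun x : ∀ v, E.Val v => x u) (fun x : ∀ v, E.Val v => x v) (E.law t)

/-- The causal Markov condition for the observational and all atomic interventional laws. -/
def Markov [Finite V] (E : Entity V) : Prop :=
  ∀ (t : Option V) (u v : V) (Z : Set V), u ≠ v → u ∉ Z → v ∉ Z →
    (E.graph t).MSep (Sum.inl u) (Sum.inl v) (Sum.inl '' Z) → E.CI t u v Z

/-- Faithfulness for the observational and all atomic interventional laws. -/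
def Faithful [Finite V] (E : Entity V) : Prop :=
  ∀ (t : Option V) (u v : V) (Z : Set V), u ≠ v → u ∉ Z → v ∉ Z →
    E.CI t u v Z → (E.graph t).MSep (Sum.inl u) (Sum.inl v) (Sum.inl '' Z)

end Entity

/-! Partial ancestral graphs -/

inductive Mark
  | tail
  | arrow
  | circle

/-- A partial mixed graph: a skeleton, and for an edge between `u` and `v` the mark `mark u v`
at its end `v`. -/
structure PartialMixedGraph (V : Type) where
  adj : V → V → Prop
  mark : V → V → Mark

open Classical in
/-- The PAG of (the Markov equivalence class of) a MAG: the adjacencies of the MAG, with an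
arrowhead or a tail exactly where all members of the class share it, and a circle elsewhere. -/
noncomputable def pag {V : Type} (G : MixedGraph V) : PartialMixedGraph V where
  adj := G.Adj
  mark u v :=
    if ∀ H ∈ G.markovClass, H.Into u v then Mark.arrow
    else if ∀ H ∈ G.markovClass, H.dir v u then Mark.tail
    else Mark.circle

namespace PartialMixedGraph

variable {V : Type}

/-- The edge between `u` and `v` is present with mark `a` at `u` and mark `b` at `v`. -/
def HasEdge (U : PartialMixedGraph V) (a : Mark) (u v : V) (b : Mark) : Prop :=
  U.adj u v ∧ U.mark v u = a ∧ U.mark u v = b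

end PartialMixedGraph

/-! The helper routines. Their input is the PAG `U` of an entity and its answers
`ci w u v` to the CI-tests "is `u` independent of `v` under do(`w`)?". -/

section Helpers

variable {V : Type} (U : PartialMixedGraph V) (ci : V → V → V → Prop)

/-- The nodes tested by Identify-OutNbr at `u`. -/
def outCandidates (u : V) : Set V :=
  {v | U.HasEdge Mark.circle u v Mark.circle ∨ U.HasEdge Mark.circle u v Mark.arrow}

/-- Identify-OutNbr. -/
def identifyOut (u : V) : Set V :=
  {v | U.HasEdge Mark.tail u v Mark.arrow} ∪ {v | v ∈ outCandidates U u ∧ ¬ ci u u v}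

/-- The intervention targets of the CI-tests made by Identify-OutNbr at `u`. -/
def outTargets (u : V) : Set V := {w | (outCandidates U u).Nonempty ∧ w = u}

/-- The nodes tested by Identify-Bidirected at `u`. -/
def biCandidates (u : V) : Set V :=
  {v | U.HasEdge Mark.circle u v Mark.circle ∨ U.HasEdge Mark.arrow u v Mark.circle ∨
    U.HasEdge Mark.circle u v Mark.arrow}

/-- Identify-Bidirected. -/
def identifyBi (u : V) : Set V :=
  {v | U.HasEdge Mark.arrow u v Mark.arrow} ∪
    {v | v ∈ biCandidates U u ∧ ci u u v ∧ ci v u v}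

/-- The intervention targets of the CI-tests made by Identify-Bidirected at `u`. -/
def biTargets (u : V) : Set V := {w | ∃ v ∈ biCandidates U u, w = u ∨ w = v}

/-- The incoming neighbours: the remaining neighbours in the PAG. -/
def identifyIn (u : V) : Set V :=
  {v | U.adj u v} \ (identifyOut U ci u ∪ identifyBi U ci u)

/-- The incidence set of `u` found by the helper routines. -/
def learnedIncidence (u : V) : Set (V × EdgeType) :=
  {x | (x.2 = EdgeType.tail ∧ x.1 ∈ identifyOut U ci u) ∨
    (x.2 = EdgeType.head ∧ x.1 ∈ identifyIn U ci u) ∨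
    (x.2 = EdgeType.bidirected ∧ x.1 ∈ identifyBi U ci u)}

/-- The number of atomic interventions made on an entity to learn the incidence set of `u`. -/
noncomputable def learnCost (u : V) : ℕ := (outTargets U u ∪ biTargets U u).ncard

end Helpers

/-! The randomized algorithms. `S` is the sample of nodes used for clustering, `t j` is the node
assigned to the entity `j`, and `pick` is the rule by which ties in the arg max are broken. -/

/-- The number of sampled nodes: the integer part of `4 log (M / δ) / (α - β) ^ 2`. -/
noncomputable def sampleSize (M : ℕ) (α β δ : ℝ) : ℕ :=
  ⌊4 * Real.log (M / δ) / (α - β) ^ 2⌋₊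

section Algorithm

variable {V : Type} {M m : ℕ} (U : Fin M → PartialMixedGraph V)
  (ci : Fin M → V → V → V → Prop)

/-- `Count(i, j)`. -/
noncomputable def count (S : Fin m → V) (i j : Fin M) : ℕ :=
  {s : Fin m | learnedIncidence (U i) (ci i) (S s) = learnedIncidence (U j) (ci j) (S s)}.ncard

/-- The graph on the entities built by (α,β)-BoundedDegree. -/
def entityGraph (α β : ℝ) (S : Fin m → V) : SimpleGraph (Fin M) :=
  SimpleGraph.fromRel fun i j => (1 - (α + β) / 2) * (m : ℝ) ≤ (count U ci S i j : ℝ)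

/-- The cluster of `i` returned by (α,β)-BoundedDegree: its connected component. -/
def foundCluster (α β : ℝ) (S : Fin m → V) (i : Fin M) : Set (Fin M) :=
  {j | (entityGraph U ci α β S).Reachable i j}

/-- The entities of the cluster `C` that are assigned to the node `u`. -/
def assigned (C : Set (Fin M)) (t : Fin M → V) (u : V) : Set (Fin M) := {j | j ∈ C ∧ t j = u}

/-- `NCount(i, u)`, relative to the set `T` of entities assigned to `u`. -/
noncomputable def nCount (T : Set (Fin M)) (i : Fin M) (u : V) : ℕ :=
  {j : Fin M | j ∈ T ∧ j ≠ i ∧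
    learnedIncidence (U i) (ci i) u = learnedIncidence (U j) (ci j) u}.ncard

/-- The entities of `T` with the largest `NCount`. -/
def maximizers (T : Set (Fin M)) (u : V) : Set (Fin M) :=
  {i | i ∈ T ∧ ∀ j ∈ T, nCount U ci T j u ≤ nCount U ci T i u}

/-- The neighbourhood given to `u` in the graph of the cluster `C` (empty if no entity is
assigned to `u`). -/
def mergedIncidence (pick : Set (Fin M) → Fin M) (C : Set (Fin M)) (t : Fin M → V) (u : V) :
    Set (V × EdgeType) :=
  {x | (assigned C t u).Nonempty ∧
    x ∈ learnedIncidence (U (pick (maximizers U ci (assigned C t u) u)))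
      (ci (pick (maximizers U ci (assigned C t u) u))) u}

/-- (α,β)-Recovery: the output graph for the entity `i`. -/
def recovery (α β : ℝ) (pick : Set (Fin M) → Fin M) (S : Fin m → V) (t : Fin M → V)
    (i : Fin M) : MixedGraph V :=
  MixedGraph.ofIncidence (mergedIncidence U ci pick (foundCluster U ci α β S i) t)

/-- The number of atomic interventions that (α,β)-Recovery makes on the entity `i`. -/
noncomputable def interventions (S : Fin m → V) (t : Fin M → V) (i : Fin M) : ℕ :=
  (∑ s : Fin m, learnCost (U i) (S s)) + learnCost (U i) (t i)

end Algorithm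

/-- The law of the random choices: the sampled nodes and the assigned nodes are independent
and uniform on `V`. -/
noncomputable def choiceLaw (V : Type) [MeasurableSpace V] (m M : ℕ) :
    Measure ((Fin m → V) × (Fin M → V)) :=
  (Measure.pi fun _ => uniformOn (Set.univ : Set V)).prod
    (Measure.pi fun _ => uniformOn (Set.univ : Set V))

/-! Clusterings -/

section Clustering

variable {V : Type} {M : ℕ} (G : Fin M → MixedGraph V)

/-- The partition `P` of the entities witnesses the `(α,β)`-clustering property. -/
def IsClustering [Fintype V] (α β : ℝ) (P : Finpartition (Finset.univ : Finset (Fin M))) : Prop :=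
  ∀ i j : Fin M,
    ((∃ C ∈ P.parts, i ∈ C ∧ j ∈ C) →
      ((G i).nodeDist (G j) : ℝ) ≤ β * (Fintype.card V : ℝ)) ∧
    ((¬ ∃ C ∈ P.parts, i ∈ C ∧ j ∈ C) →
      α * (Fintype.card V : ℝ) ≤ ((G i).nodeDist (G j) : ℝ))

/-- The fraction of the cluster `C` that shares its most frequent (dominant) graph. -/
noncomputable def dominantFraction (C : Finset (Fin M)) : ℝ :=
  ((C.sup fun i => {j : Fin M | j ∈ C ∧ G j = G i}.ncard : ℕ) : ℝ) / (C.card : ℝ)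

/-- The maximum undirected degree of the graphs. -/
noncomputable def maxDegree [Fintype V] : ℕ :=
  Finset.univ.sup fun i : Fin M => Finset.univ.sup fun u : V => ((G i).incidence u).ncard

end Clustering

end CollabCausal

open CollabCausal

/-!
The proof has a graph-theoretic and a probabilistic half.

*The helper routines are exact.* A PAG mark that is not a circle is shared by the MAG itself,
provided that the MAG belongs to its own Markov equivalence class, that is, that `D.mag` is a
maximal ancestral graph (`DAG.mag_isMAG`). For this, inducing paths between `u` and `v` are
described by a condition on single edges: they are the simple paths in `DAG.inducingGraph`, whose
edges join ancestors of `u` or `v` and point to each observed end other than `u`, `v`. The edges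
of an inducing path in `D.mag` come from inducing paths in `D`, which only use edges allowed for
`u` and `v` (`DAG.inducingGraph_le`), so that `u` and `v` are connected in `DAG.inducingGraph`.
The circle marks are resolved by interventions: under `do(u)`, the nodes `u` and `v` are
marginally d-connected exactly when `u` is an ancestor of `v` (`DAG.mutilate_mSep_empty_iff`).
Hence the learned incidence sets are the true ones (`learnedIncidence_eq`).

*Clustering.* By Hoeffding's inequality (`sample_ncard_tail`) a pair of entities is misjudged with
probability at most `exp (-m * (α - β) ^ 2 / 2)` for `m` samples, roughly `(δ / M) ^ 2`. The union
bound leaves a failure probability of at most `7 / 8 * δ` (`clustering_failure`). Rounding the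
sample size down costs more than a factor of `exp (1 / 2)` only when `α - β` exceeds one; then
there is a single cluster, and the `M - 1` pairs containing a fixed entity suffice.

*Voting.* If the entities with the dominant MAG of a cluster form a strict majority among the
entities assigned to a node, the vote returns the neighbourhood of the dominant MAG
(`incidence_eq_of_mem_maximizers`). Each entity is assigned to a given node with probability `1 /
n`, so the vote has small variance and Chernoff's bound (`assigned_majority_tail`) gives a failure
probability `exp (-|C| * (2 * γ - 1) ^ 2 / (4 * n))`, in total at most `δ / 8` (`voting_failure`).

If neither step fails, the output for an entity is the dominant MAG of its cluster: a MAG, within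
distance `β * n` by the clustering property.
-/

namespace CollabCausal

/-! ### Inducing paths and the maximality of the graph of a DAG -/

section

variable {W : Type}

theorem ne_head_of_infix {p : List W} {u a w b : W} (hn : p.Nodup) (hh : p.head? = some u)
    (h : [a, w, b] <:+: p) : w ≠ u := by
  obtain ⟨s, t, rfl⟩ := h
  rintro rfl
  cases s with
  | nil => simp at hh hn; tauto
  | cons x s => simp at hh hn; subst hh; simp at hn

theorem ne_getLast_of_infix {p : List W} {v a w b : W} (hn : p.Nodup)
    (hl : p.getLast? = some v) (h : [a, w, b] <:+: p) : w ≠ v :=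
  ne_head_of_infix (p := p.reverse) (a := b) (b := a) (by simpa using hn) (by simpa using hl)
    (by rw [← List.reverse_infix]; simpa using h)

namespace MixedGraph

theorem MConnecting.symm {G : MixedGraph W} {p : List W} {u v : W} {Z : Set W}
    (h : G.MConnecting p u v Z) : G.MConnecting p.reverse v u Z := by
  obtain ⟨⟨hc, hn, hh, hl⟩, hp⟩ := h
  refine ⟨⟨?_, by simpa using hn, by simpa using hl, by simpa using hh⟩, ?_⟩
  · rw [List.isChain_reverse]
    refine hc.imp ?_
    rintro a b (h | h | h)
    · exact Or.inr (Or.inl h)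
    · exact Or.inl h
    · exact Or.inr (Or.inr (G.bi_symm _ _ h))
  · intro a w b hw
    have h1 : [b, w, a] <:+: p := by
      rw [← List.reverse_infix]; simpa using hw
    obtain ⟨h2, h3⟩ := hp b w a h1
    exact ⟨fun h => h2 fun h' => h h'.symm, fun h => h3 h.symm⟩

theorem mSep_comm {G : MixedGraph W} {u v : W} {Z : Set W} : G.MSep u v Z ↔ G.MSep v u Z :=
  ⟨fun h ⟨_, hp⟩ => h ⟨_, hp.symm⟩, fun h ⟨_, hp⟩ => h ⟨_, hp.symm⟩⟩

end MixedGraph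

namespace DAG

variable (D : DAG W)

theorem toMixed_adj {x y : W} : D.toMixed.Adj x y ↔ D.edge x y ∨ D.edge y x := by
  simp [MixedGraph.Adj, toMixed]

theorem toMixed_into {x y : W} : D.toMixed.Into x y ↔ D.edge x y := by
  simp [MixedGraph.Into, toMixed]

variable {D}

theorem not_edge_of_anc {x y : W} (h : Relation.ReflTransGen D.edge x y) : ¬ D.edge y x :=
  fun h' => D.acyclic _ (Relation.TransGen.tail' h h')

theorem anc_antisymm {x y : W} (h : Relation.ReflTransGen D.edge x y)
    (h' : Relation.ReflTransGen D.edge y x) : x = y := by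
  rcases Relation.reflTransGen_iff_eq_or_transGen.1 h with h | h
  · exact h.symm
  · exact (D.acyclic _ (h.trans_left h')).elim

/-- Along a path in a DAG whose last node and colliders lie in an ancestral set `A`, every node
lies in `A`, as soon as the first node does or has its edge pointing forwards: from a
non-collider one can follow the arrows to a collider or to an end of the path. -/
theorem forall_mem_of_colliders {A : Set W} (hA : ∀ x y, D.edge x y → y ∈ A → x ∈ A)
    (l : List W) (x : W) (hc : (x :: l).IsChain D.toMixed.Adj)
    (hl : ∀ z, (x :: l).getLast? = some z → z ∈ A)
    (hcol : ∀ a w b, [a, w, b] <:+: x :: l → D.toMixed.Collider a w b → w ∈ A)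
    (hx : x ∈ A ∨ ∀ y ∈ l.head?, D.edge x y) : ∀ z ∈ x :: l, z ∈ A := by
  induction l generalizing x with
  | nil => simpa using hl
  | cons y l ih =>
    rw [List.isChain_cons_cons, toMixed_adj] at hc
    have hl' : ∀ z, (y :: l).getLast? = some z → z ∈ A := by simpa using hl
    have hcol' : ∀ a w b, [a, w, b] <:+: y :: l → D.toMixed.Collider a w b → w ∈ A :=
      fun a w b h => hcol a w b (h.trans (List.suffix_cons x _).isInfix)
    have key : D.edge x y → ∀ z ∈ y :: l, z ∈ A := by
      intro hxy
      cases l with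
      | nil => simpa using hl'
      | cons z l =>
        have hyz := (List.isChain_cons_cons.1 hc.2).1
        rw [toMixed_adj] at hyz
        rcases hyz with hyz | hzy
        · exact ih y hc.2 hl' hcol' (Or.inr (by simpa using hyz))
        · refine ih y hc.2 hl' hcol' (Or.inl ?_)
          refine hcol x y z ⟨[], l, by simp⟩ ⟨?_, ?_⟩ <;> rwa [toMixed_into]
    by_cases hxy : D.edge x y
    · have h := key hxy
      intro z hz
      rcases List.mem_cons.1 hz with rfl | hz
      · exact hA _ _ hxy (h y (by simp))
      · exact h z hz
    · have hyx := hc.1.resolve_left hxy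
      have hxA : x ∈ A := hx.resolve_right fun h => hxy (h y (by simp))
      have h := ih y hc.2 hl' hcol' (Or.inl (hA _ _ hyx hxA))
      intro z hz
      rcases List.mem_cons.1 hz with rfl | hz
      · exact hxA
      · exact h z hz

variable (D)

/-- The ancestors of `u` or `v`. -/
def ancestors (u v : W) : Set W :=
  {x | Relation.ReflTransGen D.edge x u ∨ Relation.ReflTransGen D.edge x v}

/-- The edges of a DAG that an inducing path between `u` and `v` relative to `S` may use: those
between ancestors of `u` or `v` with an arrowhead at each end other than `u`, `v` and the members
of `S`. Unlike the conditions on the consecutive triples of a path, this is a condition on single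
edges. -/
def inducingGraph (S : Set W) (u v : W) : SimpleGraph W where
  Adj x y := D.toMixed.Adj x y ∧ (x ∈ D.ancestors u v ∧ y ∈ D.ancestors u v) ∧
    (x ∈ S ∨ (x = u ∨ x = v) ∨ D.edge y x) ∧ (y ∈ S ∨ (y = u ∨ y = v) ∨ D.edge x y)
  symm := ⟨fun x y h => ⟨by rw [toMixed_adj] at *; exact h.1.symm, h.2.1.symm, h.2.2.2, h.2.2.1⟩⟩
  loopless := ⟨fun x h => by
    rw [toMixed_adj] at h
    exact D.acyclic x (Relation.TransGen.single (h.1.elim id id))⟩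

variable {D}

theorem inducingGraph_reachable_of_inducing {S : Set W} {u v : W}
    (h : D.toMixed.Inducing S u v) : (D.inducingGraph S u v).Reachable u v := by
  obtain ⟨p, ⟨hc, hn, hh, hl⟩, hp⟩ := h
  have hA : ∀ z ∈ p, z ∈ D.ancestors u v := by
    cases p with
    | nil => simp
    | cons x l =>
      obtain rfl : x = u := by simpa using hh
      refine forall_mem_of_colliders ?_ l x hc ?_ (fun a w b h => (hp a w b h).2)
        (Or.inl (Or.inl .refl))
      · rintro a b hab (h | h)
        · exact Or.inl (h.head hab)
        · exact Or.inr (h.head hab)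
      · intro z hz
        rw [hl] at hz
        obtain rfl : v = z := by simpa using hz
        exact Or.inr .refl
  have hv : v ∈ p := List.mem_of_getLast? hl
  -- Every suffix of `p` starting at `x` gives a connection from `x` to `v`; the node before `x`
  -- certifies the arrowhead at `x`.
  have key : ∀ (l s : List W) (x : W), p = s ++ x :: l →
      (D.inducingGraph S u v).Reachable x v := by
    intro l
    induction l with
    | nil =>
      rintro s x rfl
      obtain rfl : x = v := by simpa using hl
      exact .refl _
    | cons y l ih =>
      intro s x hs
      refine SimpleGraph.Reachable.trans (SimpleGraph.Adj.reachable ?_)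
        (ih (s ++ [x]) y (by simp [hs]))
      have hxy : D.toMixed.Adj x y :=
        (List.isChain_cons_cons.1 (List.IsChain.infix hc ⟨s, l, by simp [hs]⟩ :
          [x, y].IsChain D.toMixed.Adj)).1
      refine ⟨hxy, ⟨hA _ (by simp [hs]), hA _ (by simp [hs])⟩, ?_, ?_⟩
      · rcases List.eq_nil_or_concat s with rfl | ⟨s', a, rfl⟩
        · exact Or.inr (Or.inl (Or.inl (by simpa [hs] using hh)))
        · by_cases hxS : x ∈ S
          · exact Or.inl hxS
          · have := ((hp a x y ⟨s', l, by simp [hs]⟩).1 hxS).2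
            rw [toMixed_into] at this
            exact Or.inr (Or.inr this)
      · cases l with
        | nil => exact Or.inr (Or.inl (Or.inr (by simpa [hs] using hl)))
        | cons b l =>
          by_cases hyS : y ∈ S
          · exact Or.inl hyS
          · have := ((hp x y b ⟨s, l, by simp [hs]⟩).1 hyS).1
            rw [toMixed_into] at this
            exact Or.inr (Or.inr this)
  cases p with
  | nil => simp at hh
  | cons x l =>
    obtain rfl : x = u := by simpa using hh
    exact key l [] x rfl

/-- Conversely, a simple path of allowed edges is inducing, as its interior nodes are not ends. -/
theorem inducing_of_inducingGraph_reachable {S : Set W} {u v : W}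
    (h : (D.inducingGraph S u v).Reachable u v) : D.toMixed.Inducing S u v := by
  obtain ⟨p, hp⟩ := h.exists_isPath
  have hh : p.support.head? = some u := by
    rw [List.head?_eq_some_head p.support_ne_nil, p.head_support]
  have hl : p.support.getLast? = some v := by
    rw [List.getLast?_eq_some_getLast p.support_ne_nil, p.getLast_support]
  refine ⟨p.support, ⟨p.isChain_adj_support.imp fun _ _ h => h.1, hp.support_nodup, hh, hl⟩, ?_⟩
  intro a w b hw
  have h1 := ne_head_of_infix hp.support_nodup hh hw
  have h2 := ne_getLast_of_infix hp.support_nodup hl hw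
  have h3 := p.isChain_adj_support.infix hw
  simp only [List.isChain_cons_cons] at h3
  obtain ⟨haw, hwb, -⟩ := h3
  refine ⟨fun hwS => ⟨?_, ?_⟩, fun _ => haw.2.1.2⟩
  · rw [toMixed_into]
    have := haw.2.2.2
    tauto
  · rw [toMixed_into]
    have := hwb.2.2.1
    tauto

variable {V L : Type} {D : DAG (V ⊕ L)}

theorem transGen_of_mag_dir {u v : V} (h : D.mag.dir u v) :
    Relation.TransGen D.edge (Sum.inl u) (Sum.inl v) := by
  rcases Relation.reflTransGen_iff_eq_or_transGen.1 h.2.2 with h' | h'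
  · exact (h.1 (Sum.inl_injective h').symm).elim
  · exact h'

theorem transGen_of_mag_transGen {u v : V} (h : Relation.TransGen D.mag.dir u v) :
    Relation.TransGen D.edge (Sum.inl u) (Sum.inl v) :=
  h.lift' Sum.inl fun _ _ => transGen_of_mag_dir

theorem anc_of_mag_anc {u v : V} (h : D.mag.Anc u v) :
    Relation.ReflTransGen D.edge (Sum.inl u) (Sum.inl v) :=
  Relation.ReflTransGen.lift' Sum.inl (fun _ _ h => h.2.2) u v h

theorem mag_isAncestral : D.mag.IsAncestral :=
  ⟨fun _ h => D.acyclic _ (transGen_of_mag_transGen h), fun _ _ h =>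
    ⟨fun h' => h.2.2.1 (transGen_of_mag_transGen h').to_reflTransGen,
      fun h' => h.2.2.2 (transGen_of_mag_transGen h').to_reflTransGen⟩⟩

theorem mag_adj_iff {u v : V} : D.mag.Adj u v ↔ u ≠ v ∧
    D.toMixed.Inducing (Set.range Sum.inr) (Sum.inl u) (Sum.inl v) := by
  constructor
  · rintro (h | h | h)
    · exact ⟨h.1, h.2.1⟩
    · exact ⟨h.1.symm, h.2.1.symm⟩
    · exact ⟨h.1, h.2.1⟩
  · rintro ⟨h, h'⟩
    by_cases h1 : D.toMixed.Anc (Sum.inl u) (Sum.inl v)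
    · exact Or.inl ⟨h, h', h1⟩
    · by_cases h2 : D.toMixed.Anc (Sum.inl v) (Sum.inl u)
      · exact Or.inr (Or.inl ⟨h.symm, h'.symm, h2⟩)
      · exact Or.inr (Or.inr ⟨h, h', h1, h2⟩)

theorem mag_dir_iff {u v : V} : D.mag.dir u v ↔ D.mag.Adj u v ∧
    Relation.ReflTransGen D.edge (Sum.inl u) (Sum.inl v) := by
  rw [mag_adj_iff, and_assoc]; rfl

theorem mag_bi_iff {u v : V} : D.mag.bi u v ↔ D.mag.Adj u v ∧
    ¬ Relation.ReflTransGen D.edge (Sum.inl u) (Sum.inl v) ∧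
    ¬ Relation.ReflTransGen D.edge (Sum.inl v) (Sum.inl u) := by
  rw [mag_adj_iff, and_assoc]; rfl

theorem not_anc_of_mag_into {u v : V} (h : D.mag.Into u v) :
    ¬ Relation.ReflTransGen D.edge (Sum.inl v) (Sum.inl u) := by
  rcases h with h | h
  · exact fun h' => h.1 (Sum.inl_injective (anc_antisymm h.2.2 h'))
  · exact (mag_bi_iff.1 h).2.2

/-- An inducing path for the edge between `x` and `y` only uses edges that are allowed on an
inducing path between `u` and `v`, if each of `x`, `y` is `u` or `v` or has an arrowhead in the
maximal ancestral graph: as `x` is not an ancestor of `y`, every edge that joins `x` to an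
ancestor of `x` or `y` points to `x`. -/
theorem inducingGraph_le {S : Set (V ⊕ L)} {u v x y : V ⊕ L}
    (hx : (x = u ∨ x = v) ∨ ¬ Relation.ReflTransGen D.edge x y)
    (hy : (y = u ∨ y = v) ∨ ¬ Relation.ReflTransGen D.edge y x)
    (hxA : x ∈ D.ancestors u v) (hyA : y ∈ D.ancestors u v) :
    D.inducingGraph S x y ≤ D.inducingGraph S u v := by
  have hA : ∀ z ∈ D.ancestors x y, z ∈ D.ancestors u v := by
    rintro z (h | h)
    · exact hxA.imp h.trans h.trans
    · exact hyA.imp h.trans h.trans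
  have hend : ∀ a b, D.toMixed.Adj a b → b ∈ D.ancestors x y →
      (a ∈ S ∨ (a = x ∨ a = y) ∨ D.edge b a) → (a ∈ S ∨ (a = u ∨ a = v) ∨ D.edge b a) := by
    intro a b hab hb h
    rw [toMixed_adj] at hab
    rcases h with h | (rfl | rfl) | h
    · exact Or.inl h
    · rcases hx with hx | hx
      · exact Or.inr (Or.inl hx)
      · refine Or.inr (Or.inr (hab.resolve_left fun hab => ?_))
        rcases hb with hb | hb
        · exact not_edge_of_anc hb hab
        · exact hx (hb.head hab)
    · rcases hy with hy | hy
      · exact Or.inr (Or.inl hy)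
      · refine Or.inr (Or.inr (hab.resolve_left fun hab => ?_))
        rcases hb with hb | hb
        · exact hy (hb.head hab)
        · exact not_edge_of_anc hb hab
    · exact Or.inr (Or.inr h)
  intro a b h
  exact ⟨h.1, ⟨hA _ h.2.1.1, hA _ h.2.1.2⟩, hend a b h.1 h.2.1.2 h.2.2.1,
    hend b a (D.toMixed_adj.2 (D.toMixed_adj.1 h.1).symm) h.2.1.1 h.2.2.2⟩

/-- The graph of a DAG over its observed nodes is a maximal ancestral graph. For maximality,
an inducing path in it is expanded into a connection through the inducing paths of its edges. -/
theorem mag_isMAG : D.mag.IsMAG := by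
  refine ⟨mag_isAncestral, fun u v huv hadj hind => hadj ?_⟩
  rw [mag_adj_iff]
  refine ⟨huv, inducing_of_inducingGraph_reachable ?_⟩
  obtain ⟨p, ⟨hc, hn, hh, hl⟩, hp⟩ := hind
  have hA : ∀ a w b, [a, w, b] <:+: p → Sum.inl w ∈ D.ancestors (Sum.inl u) (Sum.inl v) :=
    fun a w b h => ((hp a w b h).2 ((hp a w b h).1 (by simp))).imp anc_of_mag_anc anc_of_mag_anc
  have key : ∀ (l s : List V) (x : V), p = s ++ x :: l →
      (D.inducingGraph (Set.range Sum.inr) (Sum.inl u) (Sum.inl v)).Reachable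
        (Sum.inl x) (Sum.inl v) := by
    intro l
    induction l with
    | nil =>
      rintro s x rfl
      obtain rfl : x = v := by simpa using hl
      exact .refl _
    | cons y l ih =>
      intro s x hs
      refine SimpleGraph.Reachable.trans ?_ (ih (s ++ [x]) y (by simp [hs]))
      have hxy : D.mag.Adj x y :=
        (List.isChain_cons_cons.1 (List.IsChain.infix hc ⟨s, l, by simp [hs]⟩ :
          [x, y].IsChain D.mag.Adj)).1
      have hx : ((x = u ∨ x = v) ∨ ¬ Relation.ReflTransGen D.edge (Sum.inl x) (Sum.inl y)) ∧
          (Sum.inl x : V ⊕ L) ∈ D.ancestors (Sum.inl u) (Sum.inl v) := by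
        rcases List.eq_nil_or_concat s with rfl | ⟨s', a, rfl⟩
        · obtain rfl : x = u := by simpa [hs] using hh
          exact ⟨Or.inl (Or.inl rfl), Or.inl .refl⟩
        · have hi : [a, x, y] <:+: p := ⟨s', l, by simp [hs]⟩
          exact ⟨Or.inr (not_anc_of_mag_into ((hp a x y hi).1 (by simp)).2), hA a x y hi⟩
      have hy : ((y = u ∨ y = v) ∨ ¬ Relation.ReflTransGen D.edge (Sum.inl y) (Sum.inl x)) ∧
          (Sum.inl y : V ⊕ L) ∈ D.ancestors (Sum.inl u) (Sum.inl v) := by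
        cases l with
        | nil =>
          obtain rfl : y = v := by simpa [hs] using hl
          exact ⟨Or.inl (Or.inr rfl), Or.inr .refl⟩
        | cons b l =>
          have hi : [x, y, b] <:+: p := ⟨s, l, by simp [hs]⟩
          exact ⟨Or.inr (not_anc_of_mag_into ((hp x y b hi).1 (by simp)).1), hA x y b hi⟩
      exact (inducingGraph_reachable_of_inducing (mag_adj_iff.1 hxy).2).mono
        (inducingGraph_le (hx.1.imp_left (by simp)) (hy.1.imp_left (by simp)) hx.2 hy.2)
  cases p with
  | nil => simp at hh
  | cons x l =>
    obtain rfl : x = u := by simpa using hh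
    exact key l [] x rfl

end DAG

end

/-! ### Marginal dependence under interventions and the learned incidence sets -/

namespace DAG

variable {W : Type} {D : DAG W}

theorem anc_of_no_collider (l : List W) (x y v : W)
    (hc : (x :: y :: l).IsChain D.toMixed.Adj) (hl : (x :: y :: l).getLast? = some v)
    (hcol : ∀ a w b, [a, w, b] <:+: x :: y :: l → ¬ D.toMixed.Collider a w b)
    (hxy : D.edge x y) : Relation.ReflTransGen D.edge x v := by
  induction l generalizing x y with
  | nil =>
    obtain rfl : y = v := by simpa using hl
    exact .single hxy
  | cons z l ih =>
    obtain ⟨-, hc⟩ := List.isChain_cons_cons.1 hc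
    refine Relation.ReflTransGen.head hxy (ih y z hc (by simpa using hl)
      (fun a w b h => hcol a w b (h.trans (List.suffix_cons x _).isInfix)) ?_)
    refine (D.toMixed_adj.1 (List.isChain_cons_cons.1 hc).1).resolve_right fun hzy => ?_
    exact hcol x y z ⟨[], l, by simp⟩ ⟨D.toMixed_into.2 hxy, D.toMixed_into.2 hzy⟩

theorem not_mSep_empty_of_anc {w v : W} (h : Relation.ReflTransGen D.edge w v) :
    ¬ D.toMixed.MSep w v ∅ := by
  obtain ⟨l, hc, hl⟩ := List.exists_isChain_cons_of_relationReflTransGen h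
  have hc' : (w :: l).Pairwise (Relation.TransGen D.edge) :=
    (hc.imp fun _ _ => Relation.TransGen.single).pairwise
  refine not_not.2 ⟨w :: l, ⟨hc.imp fun _ _ h => D.toMixed_adj.2 (Or.inl h), ?_, rfl, ?_⟩, ?_⟩
  · refine hc'.imp ?_
    rintro a _ hab rfl
    exact D.acyclic _ hab
  · rw [List.getLast?_eq_some_getLast (List.cons_ne_nil _ _), hl]
  · intro a x b hi
    have hch := hc.infix hi
    simp only [List.isChain_cons_cons] at hch
    refine ⟨fun _ => Set.notMem_empty _, fun hcol => ?_⟩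
    exact (D.acyclic x (.head hch.2.1 (.single (D.toMixed_into.1 hcol.2)))).elim

/-- Under a randomized intervention on `w`, the node `w` is d-connected marginally to exactly its
descendants: a path without colliders that starts with an edge out of `w` is directed. -/
theorem mutilate_mSep_empty_iff {w v : W} (hwv : w ≠ v) :
    (D.mutilate w).toMixed.MSep w v ∅ ↔ ¬ Relation.ReflTransGen D.edge w v := by
  constructor
  · intro h h'
    refine not_mSep_empty_of_anc ?_ h
    clear h hwv
    induction h' with
    | refl => exact .refl
    | tail hwb hbc ih => exact ih.tail ⟨hbc, fun h => not_edge_of_anc hwb (h ▸ hbc)⟩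
  · rintro h ⟨p, ⟨hc, hn, hh, hl⟩, hp⟩
    refine h ?_
    match p, hc, hh, hl, hp with
    | [], _, hh, _, _ => simp at hh
    | [x], _, hh, hl, _ =>
      simp at hh hl
      exact (hwv (hh.symm.trans hl)).elim
    | x :: y :: l, hc, hh, hl, hp =>
      obtain rfl : x = w := by simpa using hh
      have hxy := ((D.mutilate x).toMixed_adj.1 (List.isChain_cons_cons.1 hc).1).resolve_right
        fun h => h.2 rfl
      exact Relation.ReflTransGen.mono (fun _ _ h => h.1) _ _ (anc_of_no_collider l x y v hc hl
        (fun a w b hi hcol => by simpa using (hp a w b hi).2 hcol) hxy)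

end DAG

namespace Entity

variable {V : Type} [Finite V] {E : Entity V}

theorem ci_do_left_iff (hM : E.Markov) (hF : E.Faithful) {u v : V} (huv : u ≠ v) :
    E.CI (some u) u v ∅ ↔ ¬ Relation.ReflTransGen E.dag.edge (Sum.inl u) (Sum.inl v) := by
  rw [← DAG.mutilate_mSep_empty_iff (Sum.inl_injective.ne huv)]
  have h1 := hM (some u) u v ∅ huv (by simp) (by simp)
  have h2 := hF (some u) u v ∅ huv (by simp) (by simp)
  rw [Set.image_empty] at h1 h2
  exact ⟨h2, h1⟩

theorem ci_do_right_iff (hM : E.Markov) (hF : E.Faithful) {u v : V} (huv : u ≠ v) :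
    E.CI (some v) u v ∅ ↔ ¬ Relation.ReflTransGen E.dag.edge (Sum.inl v) (Sum.inl u) := by
  rw [← DAG.mutilate_mSep_empty_iff (Sum.inl_injective.ne huv.symm), MixedGraph.mSep_comm]
  have h1 := hM (some v) u v ∅ huv (by simp) (by simp)
  have h2 := hF (some v) u v ∅ huv (by simp) (by simp)
  rw [Set.image_empty] at h1 h2
  exact ⟨h2, h1⟩

end Entity

section Pag

variable {V : Type} {G : MixedGraph V} {u v : V}

theorem MixedGraph.mem_markovClass_self (hG : G.IsMAG) : G ∈ G.markovClass :=
  ⟨hG, fun _ _ _ _ _ _ => Iff.rfl⟩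

theorem pag_mark_eq_arrow_iff :
    (pag G).mark u v = Mark.arrow ↔ ∀ H ∈ G.markovClass, H.Into u v := by
  simp only [pag]
  split_ifs <;> simp_all

theorem dir_of_pag_mark_eq_tail (h : (pag G).mark u v = Mark.tail) :
    ∀ H ∈ G.markovClass, H.dir v u := by
  simp only [pag] at h
  split_ifs at h with h1 h2
  exact h2

theorem into_of_pag_mark_eq_arrow (hG : G.IsMAG) (h : (pag G).mark u v = Mark.arrow) :
    G.Into u v :=
  pag_mark_eq_arrow_iff.1 h G (MixedGraph.mem_markovClass_self hG)

/-- As there are no undirected edges, a tail in the PAG comes with an arrowhead at the other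
end. -/
theorem pag_mark_eq_arrow_of_tail (h : (pag G).mark u v = Mark.tail) :
    (pag G).mark v u = Mark.arrow :=
  pag_mark_eq_arrow_iff.2 fun H hH => Or.inl (dir_of_pag_mark_eq_tail h H hH)

end Pag

theorem Entity.mag_isMAG {V : Type} (E : Entity V) : E.mag.IsMAG := DAG.mag_isMAG

section Learning

variable {V : Type} [Finite V] {E : Entity V}

theorem identifyOut_eq (hM : E.Markov) (hF : E.Faithful) (u : V) :
    identifyOut (pag E.mag) (fun w u v => E.CI (some w) u v ∅) u = {v | E.mag.dir u v} := by
  ext v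
  simp only [identifyOut, outCandidates, PartialMixedGraph.HasEdge, Set.mem_union,
    Set.mem_ofPred_eq]
  have hG := E.mag_isMAG
  constructor
  · rintro (⟨ha, h1, h2⟩ | ⟨h, hd⟩)
    · exact dir_of_pag_mark_eq_tail h1 _ (MixedGraph.mem_markovClass_self hG)
    · have ha : E.mag.Adj u v := by rcases h with h | h <;> exact h.1
      rw [Entity.ci_do_left_iff hM hF (DAG.mag_adj_iff.1 ha).1, not_not] at hd
      exact DAG.mag_dir_iff.2 ⟨ha, hd⟩
  · intro h
    have ha : E.mag.Adj u v := Or.inl h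
    have hu : (pag E.mag).mark v u ≠ Mark.arrow := fun h' =>
      DAG.not_anc_of_mag_into (into_of_pag_mark_eq_arrow hG h') h.2.2
    have hv : (pag E.mag).mark u v ≠ Mark.tail := fun h' =>
      hu (pag_mark_eq_arrow_of_tail h')
    have hd := (Entity.ci_do_left_iff hM hF h.1).not.2 (not_not.2 h.2.2)
    have ha' : (pag E.mag).adj u v := ha
    have ht := fun h' => pag_mark_eq_arrow_of_tail (G := E.mag) (u := v) (v := u) h'
    cases hmu : (pag E.mag).mark v u <;> cases hmv : (pag E.mag).mark u v <;> simp_all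

theorem identifyBi_eq (hM : E.Markov) (hF : E.Faithful) (u : V) :
    identifyBi (pag E.mag) (fun w u v => E.CI (some w) u v ∅) u = {v | E.mag.bi u v} := by
  ext v
  simp only [identifyBi, biCandidates, PartialMixedGraph.HasEdge, Set.mem_union,
    Set.mem_ofPred_eq]
  have hG := E.mag_isMAG
  constructor
  · rintro (⟨ha, h1, h2⟩ | ⟨h, h1, h2⟩)
    · exact DAG.mag_bi_iff.2 ⟨ha, DAG.not_anc_of_mag_into (into_of_pag_mark_eq_arrow hG h1),
        DAG.not_anc_of_mag_into (into_of_pag_mark_eq_arrow hG h2)⟩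
    · have ha : E.mag.Adj u v := by rcases h with h | h | h <;> exact h.1
      have hne := (DAG.mag_adj_iff.1 ha).1
      exact DAG.mag_bi_iff.2 ⟨ha, (Entity.ci_do_left_iff hM hF hne).1 h1,
        (Entity.ci_do_right_iff hM hF hne).1 h2⟩
  · intro h
    have ha : E.mag.Adj u v := Or.inr (Or.inr h)
    have hu : (pag E.mag).mark v u ≠ Mark.tail := fun h' =>
      (DAG.mag_bi_iff.1 h).2.1 (dir_of_pag_mark_eq_tail h' _
        (MixedGraph.mem_markovClass_self hG)).2.2
    have hv : (pag E.mag).mark u v ≠ Mark.tail := fun h' =>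
      (DAG.mag_bi_iff.1 h).2.2 (dir_of_pag_mark_eq_tail h' _
        (MixedGraph.mem_markovClass_self hG)).2.2
    have h1 := (Entity.ci_do_left_iff hM hF h.1).2 (DAG.mag_bi_iff.1 h).2.1
    have h2 := (Entity.ci_do_right_iff hM hF h.1).2 (DAG.mag_bi_iff.1 h).2.2
    have ha' : (pag E.mag).adj u v := ha
    cases hmu : (pag E.mag).mark v u <;> cases hmv : (pag E.mag).mark u v <;> simp_all

/-- The helper routines learn the true incidence sets. -/
theorem learnedIncidence_eq (hM : E.Markov) (hF : E.Faithful) (u : V) :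
    learnedIncidence (pag E.mag) (fun w u v => E.CI (some w) u v ∅) u = E.mag.incidence u := by
  ext ⟨v, e⟩
  have hin : v ∈ identifyIn (pag E.mag) (fun w u v => E.CI (some w) u v ∅) u ↔
      E.mag.dir v u := by
    rw [identifyIn, identifyOut_eq hM hF, identifyBi_eq hM hF]
    change E.mag.Adj u v ∧ ¬ (E.mag.dir u v ∨ E.mag.bi u v) ↔ _
    constructor
    · rintro ⟨h | h | h, h'⟩ <;> tauto
    · intro h
      refine ⟨Or.inr (Or.inl h), ?_⟩
      rintro (h' | h')
      · exact DAG.not_anc_of_mag_into (Or.inl h') h.2.2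
      · exact h'.2.2.2 h.2.2
  simp only [learnedIncidence, MixedGraph.incidence, Set.mem_ofPred_eq, hin,
    identifyOut_eq hM hF, identifyBi_eq hM hF]

end Learning

theorem MixedGraph.ofIncidence_incidence {W : Type} (G : MixedGraph W) :
    MixedGraph.ofIncidence G.incidence = G := by
  have hs : ∀ u v, G.bi u v ↔ G.bi v u := fun u v => ⟨G.bi_symm u v, G.bi_symm v u⟩
  ext u v
  · simp [ofIncidence, incidence]
  · simp only [ofIncidence, incidence, Set.mem_ofPred_eq, reduceCtorEq, false_and, true_and,
      false_or]
    rw [hs v u, or_self]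
    exact ⟨fun h => h.2, fun h => ⟨fun h' => G.bi_irrefl v (h' ▸ h), h⟩⟩

/-! ### The number of interventions -/

section Cost

variable {V : Type} [Fintype V] {M : ℕ} {G : Fin M → MixedGraph V}

theorem ncard_setOf_adj_le (i : Fin M) (u : V) :
    {v | (G i).Adj u v}.ncard ≤ maxDegree G := by
  have h : {v | (G i).Adj u v} ⊆ Prod.fst '' (G i).incidence u := by
    rintro v (h | h | h)
    · exact ⟨(v, EdgeType.tail), Or.inl ⟨rfl, h⟩, rfl⟩
    · exact ⟨(v, EdgeType.head), Or.inr (Or.inl ⟨rfl, h⟩), rfl⟩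
    · exact ⟨(v, EdgeType.bidirected), Or.inr (Or.inr ⟨rfl, h⟩), rfl⟩
  have : Finite EdgeType := Finite.of_surjective
    (![EdgeType.tail, EdgeType.head, EdgeType.bidirected]) fun e => by
      cases e
      exacts [⟨0, rfl⟩, ⟨1, rfl⟩, ⟨2, rfl⟩]
  calc {v | (G i).Adj u v}.ncard ≤ (Prod.fst '' (G i).incidence u).ncard :=
        Set.ncard_le_ncard h (Set.toFinite _)
    _ ≤ ((G i).incidence u).ncard := Set.ncard_image_le (Set.toFinite _)
    _ ≤ Finset.univ.sup fun u : V => ((G i).incidence u).ncard :=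
        Finset.le_sup (f := fun u : V => ((G i).incidence u).ncard) (Finset.mem_univ u)
    _ ≤ maxDegree G := Finset.le_sup
        (f := fun i => Finset.univ.sup fun u : V => ((G i).incidence u).ncard) (Finset.mem_univ i)

/-- Learning the incidence set of `u` intervenes on `u` and its neighbours only. -/
theorem learnCost_le (i : Fin M) (u : V) : learnCost (pag (G i)) u ≤ maxDegree G + 1 := by
  have h : outTargets (pag (G i)) u ∪ biTargets (pag (G i)) u ⊆
      insert u {v | (G i).Adj u v} := by
    rintro w (h | ⟨v, hv, rfl | rfl⟩)
    · exact Or.inl h.2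
    · exact Or.inl rfl
    · right
      rcases hv with h | h | h <;> exact h.1
  calc learnCost (pag (G i)) u ≤ (insert u {v | (G i).Adj u v}).ncard :=
        Set.ncard_le_ncard h (Set.toFinite _)
    _ ≤ {v | (G i).Adj u v}.ncard + 1 := Set.ncard_insert_le _ _
    _ ≤ maxDegree G + 1 := by gcongr; exact ncard_setOf_adj_le i u

theorem interventions_le {α β δ : ℝ} (hM : 0 < M) (hδ : 0 < δ) (hδ1 : δ < 1)
    (S : Fin (sampleSize M α β δ) → V) (t : Fin M → V) (i : Fin M) :
    (interventions (fun i => pag (G i)) S t i : ℝ) ≤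
      (maxDegree G + 1) + 4 * (maxDegree G + 1) * Real.log (M / δ) / (α - β) ^ 2 := by
  have h1 : interventions (fun i => pag (G i)) S t i ≤
      sampleSize M α β δ * (maxDegree G + 1) + (maxDegree G + 1) := by
    refine add_le_add ?_ (learnCost_le i _)
    refine (Finset.sum_le_card_nsmul _ _ _ fun s _ => learnCost_le i (S s)).trans ?_
    simp
  have hlog : 0 ≤ Real.log (M / δ) := by
    refine Real.log_nonneg ?_
    rw [le_div_iff₀ hδ]
    have : (1 : ℝ) ≤ M := by exact_mod_cast hM
    linarith
  have h2 : (sampleSize M α β δ : ℝ) ≤ 4 * Real.log (M / δ) / (α - β) ^ 2 :=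
    Nat.floor_le (by positivity)
  calc (interventions (fun i => pag (G i)) S t i : ℝ)
      ≤ sampleSize M α β δ * (maxDegree G + 1) + (maxDegree G + 1) := by exact_mod_cast h1
    _ ≤ 4 * Real.log (M / δ) / (α - β) ^ 2 * (maxDegree G + 1) + (maxDegree G + 1) := by gcongr
    _ = _ := by ring

end Cost

/-! ### Correctness of the output for favourable random choices -/

section Recovery

variable {V : Type} {M m : ℕ} {U : Fin M → PartialMixedGraph V} {ci : Fin M → V → V → V → Prop}
  {G : Fin M → MixedGraph V}

theorem foundCluster_eq {P : Finpartition (Finset.univ : Finset (Fin M))} {α β : ℝ}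
    {S : Fin m → V}
    (hin : ∀ i j, j ∈ P.part i → (entityGraph U ci α β S).Reachable i j)
    (hout : ∀ i j, j ∉ P.part i → ¬ (entityGraph U ci α β S).Adj i j) (i : Fin M) :
    foundCluster U ci α β S i = (P.part i : Set (Fin M)) := by
  ext j
  refine ⟨fun h => ?_, fun h => hin i j h⟩
  obtain ⟨p⟩ := h
  induction p with
  | nil => exact P.mem_part_self.2 (Finset.mem_univ _)
  | cons h p ih =>
    have h' := not_not.1 fun h' => hout _ _ h' h
    rw [P.mem_part_iff_part_eq_part (Finset.mem_univ _) (Finset.mem_univ _)] at h'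
    rw [← h']
    exact ih

/-- A strict majority wins the vote: if more than half of the entities of `T` have the graph `H`,
every entity with the largest count has the incidence set of `H` at `u`. -/
theorem incidence_eq_of_mem_maximizers
    (hU : ∀ i u, learnedIncidence (U i) (ci i) u = (G i).incidence u)
    {T : Set (Fin M)} {H : MixedGraph V} (hT : T.ncard < 2 * {j | j ∈ T ∧ G j = H}.ncard) {u : V}
    {i : Fin M} (hi : i ∈ maximizers U ci T u) : (G i).incidence u = H.incidence u := by
  by_contra hne
  have hcount : ∀ k ∈ T, nCount U ci T k u + 1 =
      {j | j ∈ T ∧ (G k).incidence u = (G j).incidence u}.ncard := by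
    intro k hk
    have : {j | j ∈ T ∧ j ≠ k ∧
        learnedIncidence (U k) (ci k) u = learnedIncidence (U j) (ci j) u} =
        {j | j ∈ T ∧ (G k).incidence u = (G j).incidence u} \ {k} := by
      ext j
      simp only [hU, Set.mem_ofPred_eq, Set.mem_sdiff, Set.mem_singleton_iff]
      tauto
    rw [nCount, this]
    exact Set.ncard_sdiff_singleton_add_one ⟨hk, rfl⟩ (Set.toFinite _)
  have hA : {j | j ∈ T ∧ G j = H}.Nonempty := by
    rw [← Set.ncard_pos (Set.toFinite _)]
    omega
  obtain ⟨d, hdT, hd⟩ := hA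
  have h1 : {j | j ∈ T ∧ G j = H}.ncard ≤
      {j | j ∈ T ∧ (G d).incidence u = (G j).incidence u}.ncard :=
    Set.ncard_le_ncard (fun j hj => ⟨hj.1, by rw [hd, hj.2]⟩) (Set.toFinite _)
  have h2 := hi.2 d hdT
  have h3 := hcount d hdT
  have h4 := hcount i hi.1
  have hdisj : Disjoint {j | j ∈ T ∧ (G d).incidence u = (G j).incidence u}
      {j | j ∈ T ∧ (G i).incidence u = (G j).incidence u} := by
    rw [Set.disjoint_left]
    rintro j ⟨-, h⟩ ⟨-, h'⟩
    exact hne (by rw [h', ← h, hd])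
  have h5 := Set.ncard_union_eq hdisj (Set.toFinite _) (Set.toFinite _)
  have h6 : ({j | j ∈ T ∧ (G d).incidence u = (G j).incidence u} ∪
      {j | j ∈ T ∧ (G i).incidence u = (G j).incidence u}).ncard ≤ T.ncard :=
    Set.ncard_le_ncard (Set.union_subset (fun j hj => hj.1) fun j hj => hj.1) (Set.toFinite _)
  omega

/-- If the graph `H` has a strict majority at every node among the entities of the cluster found
for `i` that are assigned to the node, then the output for `i` is `H`. -/
theorem recovery_eq (hU : ∀ i u, learnedIncidence (U i) (ci i) u = (G i).incidence u)
    {pick : Set (Fin M) → Fin M} (hpick : ∀ A : Set (Fin M), A.Nonempty → pick A ∈ A)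
    {α β : ℝ} {S : Fin m → V} {t : Fin M → V} {i : Fin M} {H : MixedGraph V}
    (hT : ∀ u, (assigned (foundCluster U ci α β S i) t u).ncard <
      2 * {j | j ∈ assigned (foundCluster U ci α β S i) t u ∧ G j = H}.ncard) :
    recovery U ci α β pick S t i = H := by
  rw [← H.ofIncidence_incidence, recovery]
  congr 1
  ext u x
  have hA := Set.ncard_pos (s := {j | j ∈ assigned (foundCluster U ci α β S i) t u ∧ G j = H})
    (Set.toFinite _)
  have hne : (assigned (foundCluster U ci α β S i) t u).Nonempty := by
    obtain ⟨j, hj⟩ := hA.1 (by have := hT u; omega)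
    exact ⟨j, hj.1⟩
  have hp := hpick (maximizers U ci (assigned (foundCluster U ci α β S i) t u) u) (by
    obtain ⟨k, hk, hmax⟩ := Set.exists_max_image _
      (fun j => nCount U ci (assigned (foundCluster U ci α β S i) t u) j u) (Set.toFinite _) hne
    exact ⟨k, hk, hmax⟩)
  rw [← incidence_eq_of_mem_maximizers hU (hT u) hp, ← hU]
  exact ⟨fun h => h.2, fun h => ⟨hne, h⟩⟩

end Recovery

/-! ### Concentration of the random choices -/

section Concentration

theorem uniformOn_univ_real {V : Type} [Fintype V] [MeasurableSpace V]
    [DiscreteMeasurableSpace V] (A : Set V) :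
    (uniformOn (Set.univ : Set V)).real A = A.ncard / Fintype.card V := by
  classical
  rw [measureReal_def, uniformOn_univ, Measure.count_apply A.toFinite.measurableSet,
    ENNReal.toReal_div, ← Set.coe_fintypeCard, Set.ncard_eq_toFinset_card']
  simp

variable {V : Type} [Fintype V] [Nonempty V] [MeasurableSpace V] [DiscreteMeasurableSpace V]

/-- Hoeffding's inequality for the number of sampled nodes in a set of density at most `q`. -/
theorem sample_ncard_tail (m : ℕ) {A : Set V} {q ε : ℝ} (hε : 0 ≤ ε)
    (hA : (A.ncard : ℝ) ≤ q * Fintype.card V) :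
    (Measure.pi fun _ : Fin m => uniformOn (Set.univ : Set V)).real
      {S | (q + ε) * m ≤ ({s | S s ∈ A}.ncard : ℝ)} ≤ Real.exp (-(2 * m * ε ^ 2)) := by
  classical
  set ν := uniformOn (Set.univ : Set V)
  set μ := Measure.pi fun _ : Fin m => ν
  have hn : (0 : ℝ) < Fintype.card V := by exact_mod_cast Fintype.card_pos
  let f : V → ℝ := fun v => A.indicator (fun _ => 1) v - A.ncard / Fintype.card V
  have hind : iIndepFun (fun (s : Fin m) (S : Fin m → V) => f (S s)) μ :=
    iIndepFun_pi (X := fun _ => f) fun _ => (measurable_of_finite f).aemeasurable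
  have hsub : HasSubgaussianMGF f ((‖(1 : ℝ) - 0‖₊ / 2) ^ 2) ν := by
    have h := hasSubgaussianMGF_of_mem_Icc (μ := ν) (X := A.indicator fun _ => (1 : ℝ))
      (a := 0) (b := 1) (measurable_of_finite _).aemeasurable (Filter.Eventually.of_forall fun v => by
        by_cases hv : v ∈ A <;> simp [hv])
    rw [integral_indicator_const _ A.toFinite.measurableSet, uniformOn_univ_real] at h
    simpa using h
  have hsub' : ∀ s ∈ (Finset.univ : Finset (Fin m)),
      HasSubgaussianMGF (fun S : Fin m → V => f (S s)) ((‖(1 : ℝ) - 0‖₊ / 2) ^ 2) μ := by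
    intro s _
    refine HasSubgaussianMGF.of_map (Y := fun S : Fin m → V => S s) (X := f)
      (measurable_pi_apply s).aemeasurable ?_
    rwa [(measurePreserving_eval (fun _ : Fin m => ν) s).map_eq]
  have h := HasSubgaussianMGF.measure_sum_ge_le_of_iIndepFun hind hsub'
    (ε := m * ε) (by positivity)
  refine (measureReal_mono ?_).trans (h.trans (le_of_eq ?_))
  · intro S hS
    change _ ≤ ∑ s, f (S s)
    change (q + ε) * m ≤ _ at hS
    have h1 : ∑ s, f (S s) = ({s | S s ∈ A}.ncard : ℝ) - m * (A.ncard / Fintype.card V) := by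
      rw [Set.ncard_eq_toFinset_card', Finset.sum_sub_distrib]
      simp [Set.indicator_apply, Finset.sum_boole]
    have h2 : (A.ncard : ℝ) / Fintype.card V ≤ q := by rwa [div_le_iff₀ hn]
    have h3 : (m : ℝ) * (A.ncard / Fintype.card V) ≤ m * q := by gcongr
    rw [h1]
    linarith
  · congr 1
    rcases Nat.eq_zero_or_pos m with rfl | hm
    · simp
    · have : (m : ℝ) ≠ 0 := by positivity
      simp
      field_simp

/-- Chernoff's bound for the vote at `u`: the majority of a set `C` of entities stays a majority
among those of them that are assigned to `u`. The exponential moment is taken at half the bias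
of the vote. -/
theorem assigned_majority_tail {M : ℕ} (C A : Finset (Fin M)) (hAC : A ⊆ C) (u : V) {ε : ℝ}
    (hε : 0 ≤ ε) (hε1 : ε ≤ 1) (hA : (1 + ε) * C.card = 2 * A.card) :
    (Measure.pi fun _ : Fin M => uniformOn (Set.univ : Set V)).real
      {t | 2 * {j | j ∈ A ∧ t j = u}.ncard ≤ {j | j ∈ C ∧ t j = u}.ncard} ≤
      Real.exp (-(C.card * ε ^ 2 / (4 * Fintype.card V))) := by
  classical
  set ν := uniformOn (Set.univ : Set V)
  set μ := Measure.pi fun _ : Fin M => ν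
  have hn : (0 : ℝ) < Fintype.card V := by exact_mod_cast Fintype.card_pos
  let σ : Fin M → ℝ := fun j => if j ∈ A then -1 else 1
  let f : Fin M → V → ℝ := fun j v => if v = u then σ j else 0
  have hσ : ∀ j, |ε / 2 * σ j| ≤ 1 := by
    intro j
    by_cases h : j ∈ A <;> simp [σ, h, abs_le] <;> constructor <;> linarith
  have hσ2 : ∀ j, σ j ^ 2 = 1 := by
    intro j
    by_cases h : j ∈ A <;> simp [σ, h]
  have hmeas : ∀ j, Measurable (f j) := fun j => measurable_of_finite _
  have hind : iIndepFun (fun (j : Fin M) (t : Fin M → V) => f j (t j)) μ :=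
    iIndepFun_pi (X := f) fun j => (hmeas j).aemeasurable
  have hmgf : ∀ j, mgf (fun t : Fin M → V => f j (t j)) μ (ε / 2) ≤
      Real.exp ((ε / 2 * σ j + (ε / 2) ^ 2) / Fintype.card V) := by
    intro j
    have h1 : mgf (fun t : Fin M → V => f j (t j)) μ (ε / 2) =
        ∫ v, Real.exp (ε / 2 * f j v) ∂ν :=
      integral_comp_eval (μ := fun _ : Fin M => ν) (i := j)
        (f := fun v => Real.exp (ε / 2 * f j v)) (measurable_of_finite _).aestronglyMeasurable
    have h2 : (fun v => Real.exp (ε / 2 * f j v)) =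
        fun v => 1 + ({u} : Set V).indicator (fun _ => Real.exp (ε / 2 * σ j) - 1) v := by
      ext v
      by_cases h : v = u <;> simp [f, h]
    have h3 : ∫ v, Real.exp (ε / 2 * f j v) ∂ν =
        (Real.exp (ε / 2 * σ j) - 1) / Fintype.card V + 1 := by
      rw [h2, integral_add (integrable_const _) (Integrable.of_finite),
        integral_indicator_const _ (MeasurableSet.of_discrete), uniformOn_univ_real]
      simp
      ring
    rw [h1, h3]
    refine le_trans ?_ (Real.add_one_le_exp _)
    have h4 := Real.abs_exp_sub_one_sub_id_le (hσ j)
    rw [mul_pow, hσ2, mul_one] at h4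
    have h5 := (abs_le.1 h4).2
    gcongr
    linarith
  have hch := measure_ge_le_exp_mul_mgf (μ := μ)
    (X := ∑ j ∈ C, fun t : Fin M → V => f j (t j)) (t := ε / 2) 0 (by positivity)
    Integrable.of_finite
  rw [hind.mgf_sum (fun j => measurable_of_finite _)] at hch
  refine (measureReal_mono ?_).trans (hch.trans ?_)
  · intro t ht
    change 2 * _ ≤ _ at ht
    change 0 ≤ (∑ j ∈ C, fun t : Fin M → V => f j (t j)) t
    have h1 : (∑ j ∈ C, fun t : Fin M → V => f j (t j)) t =
        ({j | j ∈ C ∧ t j = u}.ncard : ℝ) - 2 * {j | j ∈ A ∧ t j = u}.ncard := by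
      have e1 : {j | j ∈ C ∧ t j = u} = ↑(C.filter fun j => t j = u) := by ext; simp
      have e2 : {j | j ∈ A ∧ t j = u} = ↑(C.filter fun j => j ∈ A ∧ t j = u) := by
        ext j; simp; exact fun h _ => hAC h
      rw [e1, e2, Set.ncard_coe_finset, Set.ncard_coe_finset, Finset.sum_apply,
        ← Finset.sum_boole, ← Finset.sum_boole, Finset.mul_sum, ← Finset.sum_sub_distrib]
      refine Finset.sum_congr rfl fun j _ => ?_
      by_cases h : t j = u <;> by_cases h' : j ∈ A <;> simp [f, σ, h, h']
      norm_num
    rw [h1, sub_nonneg]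
    exact_mod_cast ht
  · rw [mul_zero, Real.exp_zero, one_mul]
    refine (Finset.prod_le_prod (fun j _ => mgf_nonneg) fun j _ => hmgf j).trans (le_of_eq ?_)
    rw [← Real.exp_sum, ← Finset.sum_div, Finset.sum_add_distrib, ← Finset.mul_sum]
    have h1 : ∑ j ∈ C, σ j = C.card - 2 * A.card := by
      have : ∀ j ∈ C, σ j = 1 - 2 * (if j ∈ A then 1 else 0) := by
        intro j _
        by_cases h : j ∈ A <;> simp [σ, h]
        norm_num
      rw [Finset.sum_congr rfl this, Finset.sum_sub_distrib, ← Finset.mul_sum, Finset.sum_boole,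
        Finset.filter_mem_eq_inter, Finset.inter_eq_right.2 hAC]
      simp
    rw [h1, ← hA]
    congr 1
    simp
    field_simp
    ring

end Concentration

/-! ### The probability that the clustering fails -/

section ClusteringStep

/-- The union bound over all pairs of entities, for a gap `g = α - β` of at most one, when rounding
the sample size down costs a factor of at most `exp (1 / 2)`. -/
theorem all_pairs_bound {M : ℕ} {g δ : ℝ} {m : ℕ} (hM : 0 < M) (hg : 0 < g) (hg1 : g ≤ 1)
    (hδ : 0 < δ) (hδ1 : δ < 1) (hm : 4 * Real.log (M / δ) / g ^ 2 < m + 1) :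
    (M : ℝ) ^ 2 / 2 * Real.exp (-(2 * m * (g / 2) ^ 2)) ≤ 7 / 8 * δ := by
  have hM' : (0 : ℝ) < M := by exact_mod_cast hM
  rw [div_lt_iff₀ (by positivity)] at hm
  have h1 : Real.exp (-(2 * m * (g / 2) ^ 2)) ≤ 7 / 4 * (δ / M) ^ 2 := by
    have e1 : Real.exp (1 / 2) ≤ 7 / 4 := by
      have h := Real.exp_one_lt_d9
      rw [← abs_of_pos (Real.exp_pos (1 / 2)), ← abs_of_pos (show (0 : ℝ) < 7 / 4 by norm_num),
        ← sq_le_sq, ← Real.exp_nat_mul]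
      norm_num
      linarith
    have e2 : (δ / M) ^ 2 = Real.exp (-(2 * Real.log (M / δ))) := by
      rw [← Real.exp_log (show 0 < δ / M by positivity), ← Real.exp_nat_mul,
        Real.log_div hδ.ne' hM'.ne', Real.log_div hM'.ne' hδ.ne']
      congr 1
      push_cast
      ring
    have hg2 : g ^ 2 ≤ 1 := by nlinarith
    calc Real.exp (-(2 * m * (g / 2) ^ 2))
        ≤ Real.exp (1 / 2 + -(2 * Real.log (M / δ))) := by
          rw [Real.exp_le_exp]; nlinarith
      _ ≤ 7 / 4 * (δ / M) ^ 2 := by rw [Real.exp_add, e2]; gcongr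
  calc (M : ℝ) ^ 2 / 2 * Real.exp (-(2 * m * (g / 2) ^ 2))
      ≤ (M : ℝ) ^ 2 / 2 * (7 / 4 * (δ / M) ^ 2) := by gcongr
    _ = 7 / 8 * (δ * δ) := by field_simp; norm_num
    _ ≤ 7 / 8 * δ := by nlinarith

/-- The union bound over the pairs that contain a fixed entity, for a gap `g = α - β` less than
two. Rounding down halves the number of samples at worst, so `m * g ^ 2 / 2` is at least
`log (M / δ)`; this suffices for at most eight entities, and with more entities there are at
least two samples and rounding costs a third at worst. -/
theorem star_bound {M : ℕ} {g δ : ℝ} {m : ℕ} (hM : 0 < M) (hg : 0 < g) (hg2 : g < 2)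
    (hδ : 0 < δ) (hδ1 : δ < 1) (hm1 : 1 ≤ m) (hm : 4 * Real.log (M / δ) / g ^ 2 < m + 1) :
    ((M : ℝ) - 1) * Real.exp (-(2 * m * (g / 2) ^ 2)) ≤ 7 / 8 * δ := by
  have hM' : (1 : ℝ) ≤ M := by exact_mod_cast hM
  have hM0 : (0 : ℝ) < M := by linarith
  have hg4 : g ^ 2 < 4 := by nlinarith
  have hx := hm
  rw [div_lt_iff₀ (by positivity)] at hm
  have hm1' : (1 : ℝ) ≤ m := by exact_mod_cast hm1
  have eL : Real.exp (-Real.log (M / δ)) = δ / M := by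
    rw [Real.exp_neg, Real.exp_log (by positivity), inv_div]
  have hgp : 0 < g ^ 2 := by positivity
  rcases le_or_gt M 8 with h8 | h8
  · have h8' : (M : ℝ) ≤ 8 := by exact_mod_cast h8
    have h1 : Real.exp (-(2 * m * (g / 2) ^ 2)) ≤ δ / M := by
      rw [← eL, Real.exp_le_exp]
      nlinarith
    calc ((M : ℝ) - 1) * Real.exp (-(2 * m * (g / 2) ^ 2)) ≤ ((M : ℝ) - 1) * (δ / M) := by
          gcongr
      _ = ((M : ℝ) - 1) / M * δ := by ring
      _ ≤ 7 / 8 * δ := by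
          refine mul_le_mul_of_nonneg_right ?_ hδ.le
          rw [div_le_iff₀ hM0]
          linarith
  · have h9 : (9 : ℝ) ≤ M := by exact_mod_cast h8
    have hL : 2 ≤ Real.log (M / δ) := by
      rw [Real.le_log_iff_exp_le (by positivity)]
      have h := Real.exp_one_lt_d9
      have h2 : Real.exp 2 ≤ 9 := by
        rw [show (2 : ℝ) = (2 : ℕ) * 1 by norm_num, Real.exp_nat_mul]
        nlinarith [Real.exp_pos 1]
      refine h2.trans (h9.trans ?_)
      rw [le_div_iff₀ hδ]
      nlinarith
    have hm2 : (2 : ℝ) ≤ m := by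
      have h : (1 : ℝ) < m := by
        by_contra h
        nlinarith
      exact_mod_cast (show 1 < m by exact_mod_cast h)
    have h1 : Real.exp (-(2 * m * (g / 2) ^ 2)) ≤ 7 / 8 * (δ / M) := by
      have e1 : Real.exp (-(1 / 3)) ≤ 7 / 8 := by
        rw [Real.exp_neg, inv_le_comm₀ (Real.exp_pos _) (by norm_num)]
        have := Real.add_one_le_exp (1 / 3 : ℝ)
        norm_num at *
        linarith
      calc Real.exp (-(2 * m * (g / 2) ^ 2))
          ≤ Real.exp (-(1 / 3) + -Real.log (M / δ)) := by
            rw [Real.exp_le_exp]; nlinarith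
        _ ≤ 7 / 8 * (δ / M) := by rw [Real.exp_add, eL]; gcongr
    calc ((M : ℝ) - 1) * Real.exp (-(2 * m * (g / 2) ^ 2)) ≤ M * (7 / 8 * (δ / M)) := by
          gcongr; linarith
      _ = 7 / 8 * δ := by field_simp

variable {V : Type} {M m : ℕ} {U : Fin M → PartialMixedGraph V} {ci : Fin M → V → V → V → Prop}
  {G : Fin M → MixedGraph V}

theorem count_comm (S : Fin m → V) (i j : Fin M) : count U ci S i j = count U ci S j i := by
  simp only [count, eq_comm]

theorem entityGraph_adj {α β : ℝ} {S : Fin m → V} {i j : Fin M} :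
    (entityGraph U ci α β S).Adj i j ↔
      i ≠ j ∧ (1 - (α + β) / 2) * (m : ℝ) ≤ (count U ci S i j : ℝ) := by
  rw [entityGraph, SimpleGraph.fromRel_adj, count_comm S j i, or_self]

variable [Fintype V]

theorem isClustering_iff {α β : ℝ} {P : Finpartition (Finset.univ : Finset (Fin M))} :
    IsClustering G α β P ↔ ∀ i j : Fin M,
      (j ∈ P.part i → ((G i).nodeDist (G j) : ℝ) ≤ β * Fintype.card V) ∧
      (j ∉ P.part i → α * Fintype.card V ≤ ((G i).nodeDist (G j) : ℝ)) := by
  have h : ∀ i j : Fin M, (∃ C ∈ P.parts, i ∈ C ∧ j ∈ C) ↔ j ∈ P.part i := by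
    intro i j
    rw [P.mem_part_iff_exists]
    simp only [and_comm]
  simp only [IsClustering, h]

variable [Nonempty V] [MeasurableSpace V] [DiscreteMeasurableSpace V]

/-- The probability that the sample misjudges whether `i` and `j` belong to the same cluster. -/
theorem pair_failure (hU : ∀ i u, learnedIncidence (U i) (ci i) u = (G i).incidence u)
    {α β : ℝ} (hβα : β < α) {P : Finpartition (Finset.univ : Finset (Fin M))}
    (hP : IsClustering G α β P) (i j : Fin M) :
    (Measure.pi fun _ : Fin m => uniformOn (Set.univ : Set V)).real
      {S | ¬ (j ∈ P.part i ↔ (1 - (α + β) / 2) * (m : ℝ) ≤ (count U ci S i j : ℝ))} ≤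
      Real.exp (-(2 * m * ((α - β) / 2) ^ 2)) := by
  have hadd : ∀ {ι : Type} [Fintype ι] (B : Set ι), B.ncard + Bᶜ.ncard = Fintype.card ι := by
    intro ι _ B
    rw [Set.ncard_add_ncard_compl, Nat.card_eq_fintype_card]
  by_cases hij : j ∈ P.part i
  · refine (measureReal_mono ?_).trans (sample_ncard_tail m
      (A := {u | (G i).incidence u ≠ (G j).incidence u}) (q := β) (by linarith)
      ((isClustering_iff.1 hP i j).1 hij))
    intro S hS
    simp only [Set.mem_ofPred_eq, hij, true_iff, not_le] at hS
    change _ ≤ (({s | S s ∈ {u | (G i).incidence u ≠ (G j).incidence u}}.ncard : ℕ) : ℝ)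
    have h := hadd {s : Fin m | (G i).incidence (S s) = (G j).incidence (S s)}
    rw [Fintype.card_fin] at h
    have h' : ((count U ci S i j : ℕ) : ℝ) +
        (({s | S s ∈ {u | (G i).incidence u ≠ (G j).incidence u}}.ncard : ℕ) : ℝ) = m := by
      simp only [count, hU]
      exact_mod_cast h
    linarith
  · refine (measureReal_mono ?_).trans (sample_ncard_tail m
      (A := {u | (G i).incidence u = (G j).incidence u}) (q := 1 - α) (by linarith) ?_)
    · intro S hS
      simp only [Set.mem_ofPred_eq, hij, false_iff, not_not, count, hU] at hS
      refine le_trans (le_of_eq ?_) hS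
      ring
    · have h := hadd {u : V | (G i).incidence u = (G j).incidence u}
      have h' : (({u : V | (G i).incidence u = (G j).incidence u}.ncard : ℕ) : ℝ) +
          ((G i).nodeDist (G j) : ℝ) = Fintype.card V := by exact_mod_cast h
      have := (isClustering_iff.1 hP i j).2 hij
      linarith

/-- The clusters found are the true ones up to a probability of `7 / 8 * δ`. A gap `α - β` above
one leaves room for a single cluster only, and it is enough to join all entities to one of them. -/
theorem clustering_failure (hU : ∀ i u, learnedIncidence (U i) (ci i) u = (G i).incidence u)
    {α β δ : ℝ} (hM : 0 < M) (hβ : 0 ≤ β) (hβα : β < α) (hδ : 0 < δ) (hδ1 : δ < 1)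
    {P : Finpartition (Finset.univ : Finset (Fin M))} (hP : IsClustering G α β P) :
    (Measure.pi fun _ : Fin (sampleSize M α β δ) => uniformOn (Set.univ : Set V)).real
      {S | ¬ ∀ i, foundCluster U ci α β S i = (P.part i : Set (Fin M))} ≤ 7 / 8 * δ := by
  have hn : (0 : ℝ) < Fintype.card V := by exact_mod_cast Fintype.card_pos
  have hfl : 4 * Real.log (M / δ) / (α - β) ^ 2 < sampleSize M α β δ + 1 := Nat.lt_floor_add_one _
  set m := sampleSize M α β δ
  set μ := Measure.pi fun _ : Fin m => uniformOn (Set.univ : Set V)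
  let bad : Fin M → Fin M → Set (Fin m → V) := fun i j =>
    {S | ¬ (j ∈ P.part i ↔ (1 - (α + β) / 2) * (m : ℝ) ≤ (count U ci S i j : ℝ))}
  have hbad : ∀ i j, μ.real (bad i j) ≤ Real.exp (-(2 * m * ((α - β) / 2) ^ 2)) :=
    fun i j => pair_failure hU hβα hP i j
  rcases le_or_gt (α - β) 1 with hg | hg
  · have hsub : {S | ¬ ∀ i, foundCluster U ci α β S i = (P.part i : Set (Fin M))} ⊆
        ⋃ i ∈ (Finset.univ : Finset (Fin M)), ⋃ j ∈ Finset.Iio i, bad i j := by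
      intro S hS
      by_contra hS'
      refine hS (foundCluster_eq ?_ ?_)
      all_goals
        have hlt : ∀ i j, j < i →
            (j ∈ P.part i ↔ (1 - (α + β) / 2) * (m : ℝ) ≤ (count U ci S i j : ℝ)) := by
          intro i j hij
          by_contra h
          exact hS' (Set.mem_biUnion (Finset.mem_univ i)
            (Set.mem_biUnion (Finset.mem_Iio.2 hij) h))
        have hne : ∀ i j, i ≠ j →
            (j ∈ P.part i ↔ (1 - (α + β) / 2) * (m : ℝ) ≤ (count U ci S i j : ℝ)) := by
          intro i j hij
          rcases lt_or_gt_of_ne hij with h | h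
          · rw [count_comm, ← hlt j i h, P.mem_part_iff_part_eq_part (by simp) (by simp),
              P.mem_part_iff_part_eq_part (by simp) (by simp), eq_comm]
          · exact hlt i j h
        intro i j hij
      · by_cases h : i = j
        · exact h ▸ .refl _
        · exact (entityGraph_adj.2 ⟨h, (hne i j h).1 hij⟩).reachable
      · exact fun h => hij ((hne i j (entityGraph_adj.1 h).1).2 (entityGraph_adj.1 h).2)
    calc μ.real _ ≤ μ.real (⋃ i ∈ (Finset.univ : Finset (Fin M)), ⋃ j ∈ Finset.Iio i, bad i j) :=
          measureReal_mono hsub (measure_ne_top _ _)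
      _ ≤ ∑ i, μ.real (⋃ j ∈ Finset.Iio i, bad i j) := measureReal_biUnion_finset_le _ _
      _ ≤ ∑ i : Fin M, (i : ℕ) * Real.exp (-(2 * m * ((α - β) / 2) ^ 2)) := by
          refine Finset.sum_le_sum fun i _ => (measureReal_biUnion_finset_le _ _).trans ?_
          refine (Finset.sum_le_card_nsmul _ _ _ fun j _ => hbad i j).trans ?_
          simp
      _ ≤ (M : ℝ) ^ 2 / 2 * Real.exp (-(2 * m * ((α - β) / 2) ^ 2)) := by
          rw [← Finset.sum_mul]
          gcongr
          have h : (∑ i : Fin M, (i : ℕ)) * 2 ≤ M ^ 2 := by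
            rw [Fin.sum_univ_eq_sum_range (fun i => i) M, Finset.sum_range_id_mul_two, sq]
            gcongr
            omega
          have h' : (∑ i : Fin M, ((i : ℕ) : ℝ)) * 2 ≤ (M : ℝ) ^ 2 := by exact_mod_cast h
          linarith
      _ ≤ 7 / 8 * δ := all_pairs_bound hM (by linarith) hg hδ hδ1 hfl
  · have huniv : ∀ i j, j ∈ P.part i := by
      intro i j
      by_contra h
      have h1 := (isClustering_iff.1 hP i j).2 h
      have h2 : ((G i).nodeDist (G j) : ℝ) ≤ Fintype.card V := by
        rw [← Nat.card_eq_fintype_card]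
        exact_mod_cast Set.ncard_le_card _
      nlinarith
    let r : Fin M := ⟨0, hM⟩
    have hgood : ∀ S : Fin m → V, (∀ j, j ≠ r → (1 - (α + β) / 2) * (m : ℝ) ≤ (count U ci S r j : ℝ)) →
        ∀ i, foundCluster U ci α β S i = (P.part i : Set (Fin M)) := by
      intro S hS
      refine foundCluster_eq (fun i j _ => ?_) fun i j h => (h (huniv i j)).elim
      have hr : ∀ j, (entityGraph U ci α β S).Reachable r j := by
        intro j
        by_cases h : r = j
        · exact h ▸ .refl _
        · exact (entityGraph_adj.2 ⟨h, hS j (Ne.symm h)⟩).reachable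
      exact (hr i).symm.trans (hr j)
    by_cases htriv : (1 - (α + β) / 2) * (m : ℝ) ≤ 0
    · have : {S : Fin m → V | ¬ ∀ i, foundCluster U ci α β S i = (P.part i : Set (Fin M))} = ∅ := by
        ext S
        simpa using hgood S fun j _ => htriv.trans (by positivity)
      rw [this, measureReal_empty]
      positivity
    · have hm1 : 1 ≤ m := by
        by_contra h
        have : m = 0 := by omega
        simp [this] at htriv
      have hg2 : α - β < 2 := by
        by_contra h
        refine htriv (mul_nonpos_of_nonpos_of_nonneg (by linarith) (by positivity))
      have hsub : {S | ¬ ∀ i, foundCluster U ci α β S i = (P.part i : Set (Fin M))} ⊆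
          ⋃ j ∈ Finset.univ.erase r, bad r j := by
        intro S hS
        by_contra hS'
        refine hS (hgood S fun j hj => ?_)
        by_contra h
        refine hS' (Set.mem_biUnion (Finset.mem_coe.2 (Finset.mem_erase.2 ⟨hj, Finset.mem_univ j⟩))
          fun h' => h (h'.1 (huniv r j)))
      calc μ.real _ ≤ μ.real (⋃ j ∈ Finset.univ.erase r, bad r j) :=
            measureReal_mono hsub (measure_ne_top _ _)
        _ ≤ ∑ j ∈ Finset.univ.erase r, μ.real (bad r j) := measureReal_biUnion_finset_le _ _
        _ ≤ ((M : ℝ) - 1) * Real.exp (-(2 * m * ((α - β) / 2) ^ 2)) := by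
            refine (Finset.sum_le_card_nsmul _ _ _ fun j _ => hbad r j).trans ?_
            rw [Finset.card_erase_of_mem (Finset.mem_univ r), nsmul_eq_mul, Finset.card_univ,
              Fintype.card_fin, Nat.cast_sub hM, Nat.cast_one]
        _ ≤ 7 / 8 * δ := star_bound hM (by linarith) hg2 hδ hδ1 hm1 hfl

end ClusteringStep

/-! ### The probability that a vote fails -/

section VotingStep

variable {V : Type} {M : ℕ} {G : Fin M → MixedGraph V}

/-- The dominant fraction of a cluster is attained by the graph of one of its entities. -/
theorem exists_dominant {C : Finset (Fin M)} (hC : C.Nonempty) : ∃ i ∈ C,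
    dominantFraction G C * C.card = ({j : Fin M | j ∈ C ∧ G j = G i}.ncard : ℝ) := by
  obtain ⟨i, hi, h⟩ := Finset.exists_mem_eq_sup C hC
    fun i => {j : Fin M | j ∈ C ∧ G j = G i}.ncard
  refine ⟨i, hi, ?_⟩
  have : (C.card : ℝ) ≠ 0 := by exact_mod_cast hC.card_pos.ne'
  rw [dominantFraction, h]
  field_simp

variable [Fintype V] [Nonempty V] [MeasurableSpace V] [DiscreteMeasurableSpace V]

/-- For a cluster in which a fraction `γ` of the entities has the graph `H`, the vote at one node
fails with a probability at most `δ / (8 * n * M)`. On a single node every entity takes part in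
the vote, so that it cannot fail. -/
theorem vote_failure {C : Finset (Fin M)} {H : MixedGraph V} {γ δ : ℝ} (hM : 0 < M)
    (hδ : 0 < δ) (hδ1 : δ < 1) (hC : C.Nonempty) (hγ : 1 / 2 < γ)
    (hH : γ * C.card = ({j : Fin M | j ∈ C ∧ G j = H}.ncard : ℝ))
    (hcard : 16 * (Fintype.card V * Real.log (Fintype.card V * M / δ) / (2 * γ - 1) ^ 2) ≤
      (C.card : ℝ)) (u : V) :
    (Measure.pi fun _ : Fin M => uniformOn (Set.univ : Set V)).real
      {t | 2 * {j | (j ∈ C ∧ G j = H) ∧ t j = u}.ncard ≤ {j | j ∈ C ∧ t j = u}.ncard} ≤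
      δ / (8 * (Fintype.card V * M)) := by
  classical
  have hM' : (1 : ℝ) ≤ M := by exact_mod_cast hM
  have hn : (0 : ℝ) < Fintype.card V := by exact_mod_cast Fintype.card_pos
  have hCp : (0 : ℝ) < C.card := by exact_mod_cast hC.card_pos
  have hcoe : {j : Fin M | j ∈ C ∧ G j = H} = ↑(C.filter fun j => G j = H) := by ext; simp
  have hsub : C.filter (fun j => G j = H) ⊆ C := Finset.filter_subset _ _
  rw [hcoe, Set.ncard_coe_finset] at hH
  have hle : ((C.filter fun j => G j = H).card : ℝ) ≤ C.card := by
    exact_mod_cast Finset.card_le_card hsub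
  have hγ1 : γ ≤ 1 := by
    by_contra h
    nlinarith
  rcases subsingleton_or_nontrivial V with hV | hV
  · have : {t : Fin M → V | 2 * {j | (j ∈ C ∧ G j = H) ∧ t j = u}.ncard ≤
        {j | j ∈ C ∧ t j = u}.ncard} = ∅ := by
      ext t
      have e1 : {j | (j ∈ C ∧ G j = H) ∧ t j = u} = ↑(C.filter fun j => G j = H) := by
        ext j; simp [Subsingleton.elim (t j) u]
      have e2 : {j | j ∈ C ∧ t j = u} = ↑C := by ext j; simp [Subsingleton.elim (t j) u]
      simp only [Set.mem_ofPred_eq, e1, e2, Set.ncard_coe_finset, Set.mem_empty_iff_false,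
        iff_false, not_le]
      have h : (C.card : ℝ) < 2 * (C.filter fun j => G j = H).card := by nlinarith
      exact_mod_cast h
    rw [this, measureReal_empty]
    positivity
  · have hn2 : (2 : ℝ) ≤ Fintype.card V := by
      exact_mod_cast Fintype.one_lt_card (α := V)
    have htail := assigned_majority_tail C _ hsub u (ε := 2 * γ - 1) (by linarith) (by linarith)
      (by rw [← hH]; ring)
    have hset : {t : Fin M → V | 2 * {j | (j ∈ C ∧ G j = H) ∧ t j = u}.ncard ≤
        {j | j ∈ C ∧ t j = u}.ncard} = {t : Fin M → V |
        2 * {j | j ∈ C.filter (fun j => G j = H) ∧ t j = u}.ncard ≤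
        {j | j ∈ C ∧ t j = u}.ncard} := by simp only [Finset.mem_filter]
    rw [hset]
    refine htail.trans ?_
    set N : ℝ := Fintype.card V * M
    have hN : 2 ≤ N := by nlinarith
    have hε : 0 < (2 * γ - 1) ^ 2 := by have : 0 < 2 * γ - 1 := by linarith
                                        positivity
    rw [← mul_div_assoc, div_le_iff₀ hε] at hcard
    calc Real.exp (-(C.card * (2 * γ - 1) ^ 2 / (4 * Fintype.card V)))
        ≤ Real.exp (-(4 * Real.log (N / δ))) := by
          rw [Real.exp_le_exp, neg_le_neg_iff, le_div_iff₀ (by positivity)]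
          linarith
      _ = (δ / N) ^ 4 := by
          rw [← inv_div N δ, inv_pow, Real.exp_neg, ← Real.exp_log (show 0 < N / δ by positivity),
            ← Real.exp_nat_mul, Real.log_exp]
          norm_num
      _ = δ / N * (δ / N) ^ 3 := by ring
      _ ≤ δ / N * (1 / 2) ^ 3 := by
          have hq : δ / N ≤ 1 / 2 := by
            rw [div_le_div_iff₀ (by positivity) (by norm_num)]
            linarith
          gcongr
      _ = δ / (8 * N) := by field_simp; norm_num

/-- The union bound over all clusters, of which there are at most `M`, and all nodes. -/
theorem voting_failure {P : Finpartition (Finset.univ : Finset (Fin M))}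
    {H : Finset (Fin M) → MixedGraph V} {δ : ℝ} (hM : 0 < M) (hδ : 0 < δ) (hδ1 : δ < 1)
    (hP : ∀ C ∈ P.parts, 1 / 2 < dominantFraction G C ∧
      16 * (Fintype.card V * Real.log (Fintype.card V * M / δ) /
        (2 * dominantFraction G C - 1) ^ 2) ≤ (C.card : ℝ))
    (hH : ∀ C ∈ P.parts,
      dominantFraction G C * C.card = ({j : Fin M | j ∈ C ∧ G j = H C}.ncard : ℝ)) :
    (Measure.pi fun _ : Fin M => uniformOn (Set.univ : Set V)).real
      {t | ¬ ∀ C ∈ P.parts, ∀ u, {j | j ∈ C ∧ t j = u}.ncard <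
        2 * {j | (j ∈ C ∧ G j = H C) ∧ t j = u}.ncard} ≤ 1 / 8 * δ := by
  set μ := Measure.pi fun _ : Fin M => uniformOn (Set.univ : Set V)
  have hM' : (0 : ℝ) < M := by exact_mod_cast hM
  have hn : (0 : ℝ) < Fintype.card V := by exact_mod_cast Fintype.card_pos
  let bad : Finset (Fin M) → V → Set (Fin M → V) := fun C u =>
    {t | 2 * {j | (j ∈ C ∧ G j = H C) ∧ t j = u}.ncard ≤ {j | j ∈ C ∧ t j = u}.ncard}
  calc μ.real _ ≤ μ.real (⋃ C ∈ P.parts, ⋃ u ∈ (Finset.univ : Finset V), bad C u) := by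
        refine measureReal_mono (fun t ht => ?_) (measure_ne_top _ _)
        by_contra h
        refine ht fun C hC u => ?_
        by_contra h'
        exact h (Set.mem_biUnion hC (Set.mem_biUnion (Finset.mem_univ u) (not_lt.1 h')))
    _ ≤ ∑ C ∈ P.parts, ∑ u, μ.real (bad C u) :=
        (measureReal_biUnion_finset_le _ _).trans
          (Finset.sum_le_sum fun C _ => measureReal_biUnion_finset_le _ _)
    _ ≤ ∑ C ∈ P.parts, ∑ _u : V, δ / (8 * (Fintype.card V * M)) :=
        Finset.sum_le_sum fun C hC => Finset.sum_le_sum fun u _ =>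
          vote_failure hM hδ hδ1 (P.nonempty_of_mem_parts hC) (hP C hC).1 (hH C hC) (hP C hC).2 u
    _ = P.parts.card * (δ / (8 * M)) := by
        simp only [Finset.sum_const, Finset.card_univ, nsmul_eq_mul]
        field_simp
    _ ≤ M * (δ / (8 * M)) := by
        gcongr
        simpa using P.card_parts_le_card
    _ = 1 / 8 * δ := by field_simp

end VotingStep

end CollabCausal

theorem theorem1 :
    ∃ K : ℝ, 0 < K ∧
      ∀ (V : Type) [Fintype V] [Nonempty V] [MeasurableSpace V] [DiscreteMeasurableSpace V]
        (M : ℕ) (E : Fin M → Entity V) (α β δ : ℝ)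
        (P : Finpartition (Finset.univ : Finset (Fin M)))
        (pick : Set (Fin M) → Fin M),
        0 < M →
        0 ≤ β → β < α → 0 < δ → δ < 1 →
        (∀ i, (E i).Markov) → (∀ i, (E i).Faithful) →
        (∀ A : Set (Fin M), A.Nonempty → pick A ∈ A) →
        IsClustering (fun i => (E i).mag) α β P →
        (∀ C ∈ P.parts, 1 / 2 < dominantFraction (fun i => (E i).mag) C ∧
          K * (Fintype.card V * Real.log (Fintype.card V * M / δ) /
            (2 * dominantFraction (fun i => (E i).mag) C - 1) ^ 2) ≤ (C.card : ℝ)) →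
        1 - δ ≤ (choiceLaw V (sampleSize M α β δ) M).real
          {ω | ∀ i,
            (recovery (fun i => pag (E i).mag) (fun i w u v => (E i).CI (some w) u v ∅)
              α β pick ω.1 ω.2 i).IsMAG ∧
            ((E i).mag.nodeDist
              (recovery (fun i => pag (E i).mag) (fun i w u v => (E i).CI (some w) u v ∅)
                α β pick ω.1 ω.2 i) : ℝ) ≤ β * (Fintype.card V : ℝ)} ∧
        ∀ (S : Fin (sampleSize M α β δ) → V) (t : Fin M → V) (i : Fin M),
          (interventions (fun i => pag (E i).mag) S t i : ℝ) ≤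
            ((maxDegree fun i => (E i).mag) + 1) +
              4 * ((maxDegree fun i => (E i).mag) + 1) * Real.log (M / δ) / (α - β) ^ 2 := by
  -- With `K = 16` a single vote fails with probability at most `(δ / (n * M)) ^ 4`.
  refine ⟨16, by norm_num, ?_⟩
  intro V _ _ _ _ M E α β δ P pick hM hβ hβα hδ hδ1 hMarkov hFaithful hpick hP hC
  refine ⟨?_, interventions_le hM hδ hδ1⟩
  set G : Fin M → MixedGraph V := fun i => (E i).mag
  set U : Fin M → PartialMixedGraph V := fun i => pag (E i).mag
  set ci : Fin M → V → V → V → Prop := fun i w u v => (E i).CI (some w) u v ∅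
  have hU : ∀ i u, learnedIncidence (U i) (ci i) u = (G i).incidence u :=
    fun i u => learnedIncidence_eq (hMarkov i) (hFaithful i) u
  have : Nonempty (Fin M) := ⟨⟨0, hM⟩⟩
  choose! r hr hdom using fun C (hC : C ∈ P.parts) =>
    exists_dominant (G := G) (P.nonempty_of_mem_parts hC)
  set μ := Measure.pi fun _ : Fin (sampleSize M α β δ) => uniformOn (Set.univ : Set V)
  set ν := Measure.pi fun _ : Fin M => uniformOn (Set.univ : Set V)
  set B₁ : Set (Fin (sampleSize M α β δ) → V) :=
    {S | ¬ ∀ i, foundCluster U ci α β S i = (P.part i : Set (Fin M))}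
  set B₂ : Set (Fin M → V) := {t | ¬ ∀ C ∈ P.parts, ∀ u, {j | j ∈ C ∧ t j = u}.ncard <
    2 * {j | (j ∈ C ∧ G j = G (r C)) ∧ t j = u}.ncard}
  have h1 : μ.real B₁ ≤ 7 / 8 * δ := clustering_failure hU hM hβ hβα hδ hδ1 hP
  have h2 : ν.real B₂ ≤ 1 / 8 * δ := voting_failure (H := fun C => G (r C)) hM hδ hδ1 hC hdom
  set good := {ω : (Fin (sampleSize M α β δ) → V) × (Fin M → V) | ∀ i,
    (recovery U ci α β pick ω.1 ω.2 i).IsMAG ∧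
      ((E i).mag.nodeDist (recovery U ci α β pick ω.1 ω.2 i) : ℝ) ≤ β * (Fintype.card V : ℝ)}
  have hcover : (Set.univ : Set ((Fin (sampleSize M α β δ) → V) × (Fin M → V))) ⊆
      good ∪ (B₁ ×ˢ Set.univ ∪ Set.univ ×ˢ B₂) := by
    rintro ⟨S, t⟩ -
    by_cases hS : S ∈ B₁
    · exact Or.inr (Or.inl ⟨hS, trivial⟩)
    by_cases ht : t ∈ B₂
    · exact Or.inr (Or.inr ⟨trivial, ht⟩)
    left
    intro i
    have hS' := not_not.1 hS i
    have hpart : P.part i ∈ P.parts := P.part_mem.2 (Finset.mem_univ i)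
    have hrec : recovery U ci α β pick S t i = G (r (P.part i)) := by
      refine recovery_eq hU hpick fun u => ?_
      rw [hS']
      refine (not_not.1 ht _ hpart u).trans_eq ?_
      congr 2
      ext j
      simp only [assigned, Set.mem_ofPred_eq, Finset.mem_coe]
      tauto
    change (recovery U ci α β pick S t i).IsMAG ∧ _
    rw [hrec]
    exact ⟨(E _).mag_isMAG, (isClustering_iff.1 hP i _).1 (hr _ hpart)⟩
  have hle := (measureReal_mono (μ := μ.prod ν) hcover).trans
    ((measureReal_union_le _ _).trans (add_le_add le_rfl (measureReal_union_le _ _)))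
  rw [measureReal_prod_prod, measureReal_prod_prod, probReal_univ, probReal_univ,
    probReal_univ, mul_one, one_mul] at hle
  change 1 - δ ≤ (μ.prod ν).real good
  linarith
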